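/- All points and lines are in the real projective plane; $XY$ is the line through distinct points $X,Y$, and $l\wedge m$ is the intersection point of distinct lines $l,m$. Let $A,\bar A,B,\bar B,C,\bar C$ be six points, no four of them collinear, let $$D:=AB\wedge\bar A\bar B,\qquad E:=BC\wedge\bar B\bar C,\qquad F:=CA\wedge\bar C\bar A,$$ assume that the nine points $A,\bar A,B,\bar B,C,\bar C,D,E,F$ are pairwise distinct (so in particular $\{A,\bar A\},\{B,\bar B\},\{C,\bar C\}$ are not the pairs of opposite vertices of one complete quadrilateral), and let $\Gamma$ be an irreducible cubic curve through these nine points. The *Schroeter pairs* are the unordered pairs of points obtained from $\{A,\bar A\},\{B,\bar B\},\{C,\bar C\}$ by repeatedly forming, from two pairs $\{P,\bar P\}$ and $\{Q,\bar Q\}$, the pair $PQ\wedge\bar P\bar Q,\ P\bar Q\wedge\bar PQ$, whenever these lines and intersection points are defined. A point or line is *constructible by ruler alone* if it is obtained from $A,\bar A,B,\bar B,C,\bar C$ by finitely many steps of joining two distinct constructed points and intersecting two distinct constructed lines. A *line involution* on the pencil of lines through a point is an involution $l\mapsto\bar l$ of the pencil such that, whenever $l_1,l_2,l_3,l_4$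 are four distinct lines among three different pairs of conjugate lines $a,\bar a,b,\bar b,c,\bar c$, each pair being represented, $\operatorname{cr}(l_1,l_2,l_3,l_4)=\operatorname{cr}(\bar l_1,\bar l_2,\bar l_3,\bar l_4)$. For points $P,Q$ of $\Gamma$ let $P\#Q$ be the third intersection point, counting multiplicities, of $\Gamma$ with the line $PQ$, which for $P=Q$ is the tangent of $\Gamma$ at $P$. Then for every Schroeter pair $P,\bar P$ we have $P\ne\bar P$, both points are nonsingular points of $\Gamma$, and: (a) The tangent of $\Gamma$ at $P$ can be constructed by a line involution: there are Schroeter pairs $Q,\bar Q$ and $S,\bar S$ such that $PQ,P\bar Q,PS,P\bar S$ are four distinct lines; and for all Schroeter pairs $Q,\bar Q$ and $S,\bar S$ with this property, there is a line involution on the pencil of $P$ with the conjugate pairs $PQ,P\bar Q$ and $PS,P\bar S$, and every such line involution maps the line $P\bar P$ to the tangent of $\Gamma$ at $P$. The tangent at $P$ is constructible by ruler alone. The same holds for the tangent at $\bar P$. (b) The tangents of $\Gamma$ at $P$ and at $\bar P$ are distinct, and their intersection point is $P\#P=\bar P\#\bar P$. This point lies on $\Gamma$ and is constructible by ruler alone.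 -/

import Mathlib

open MvPolynomial
open scoped LinearAlgebra.Projectivization Matrix

noncomputable section

/-- Points of the real projective plane, in homogeneous coordinates. -/
abbrev ProjPoint : Type := ℙ ℝ (Fin 3 → ℝ)

/-- Lines of the real projective plane, in homogeneous line coordinates: the line with coordinates
`u` consists of the points `x` with `u ⬝ᵥ x = 0`. -/
abbrev ProjLine : Type := ℙ ℝ (Fin 3 → ℝ)

/-- Incidence of a point and a line. -/
def OnLine (P : ProjPoint) (l : ProjLine) : Prop := Projectivization.orthogonal P l

/-- The line `PQ` through two distinct points (only used for `P ≠ Q`). -/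
def join (P Q : ProjPoint) : ProjLine := Projectivization.cross P Q

/-- The intersection point `l ∧ m` of two distinct lines (only used for `l ≠ m`). -/
def meet (l m : ProjLine) : ProjPoint := Projectivization.cross l m

/-- No four points of the set `s` are collinear. -/
def NoFourCollinear (s : Set ProjPoint) : Prop :=
  ∀ t ⊆ s, t.ncard = 4 → ¬ ∃ l : ProjLine, ∀ X ∈ t, OnLine X l

/-! ### Schroeter's construction -/

/-- The pairs of Schroeter points generated by the three pairs `A, A'`, `B, B'`, `C, C'`. The two
points of a pair play the same role (`symm`). From two pairs `P, P'` and `Q, Q'` one constructs the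
pair `PQ ∧ P'Q'`, `PQ' ∧ P'Q`, provided the four lines are defined and the lines to be intersected
are distinct. -/
inductive SchroeterPair (A A' B B' C C' : ProjPoint) : ProjPoint → ProjPoint → Prop
  | baseA : SchroeterPair A A' B B' C C' A A'
  | baseB : SchroeterPair A A' B B' C C' B B'
  | baseC : SchroeterPair A A' B B' C C' C C'
  | symm {P P' : ProjPoint} :
      SchroeterPair A A' B B' C C' P P' → SchroeterPair A A' B B' C C' P' P
  | step {P P' Q Q' : ProjPoint} :
      SchroeterPair A A' B B' C C' P P' → SchroeterPair A A' B B' C C' Q Q' →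
      P ≠ Q → P' ≠ Q' → P ≠ Q' → P' ≠ Q →
      join P Q ≠ join P' Q' → join P Q' ≠ join P' Q →
      SchroeterPair A A' B B' C C'
        (meet (join P Q) (join P' Q')) (meet (join P Q') (join P' Q))

/-! ### Ruler constructions -/

/-- The points constructible by ruler alone from the points of `s`: the given points, and the
intersections of two distinct lines each of which joins two distinct constructible points.
No arbitrary auxiliary points are allowed. -/
inductive RulerPoint (s : Set ProjPoint) : ProjPoint → Prop
  | given {P : ProjPoint} : P ∈ s → RulerPoint s P
  | inter {P Q R S : ProjPoint} :
      RulerPoint s P → RulerPoint s Q → RulerPoint s R → RulerPoint s S →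
      P ≠ Q → R ≠ S → join P Q ≠ join R S →
      RulerPoint s (meet (join P Q) (join R S))

/-- The lines constructible by ruler alone from the points of `s`. -/
def RulerLine (s : Set ProjPoint) (l : ProjLine) : Prop :=
  ∃ P Q : ProjPoint, RulerPoint s P ∧ RulerPoint s Q ∧ P ≠ Q ∧ l = join P Q

/-! ### Line involutions -/

/-- The cross-ratio `cr(a, b, x, y)` of four pairwise distinct lines through the point `S`. On the
two-dimensional space of coordinate vectors of lines through `S`, the determinant `det(S, ·, ·)`
is an area form; the cross-ratio does not depend on the representatives. -/
def crossRatio (S : ProjPoint) (a b x y : ProjLine) : ℝ :=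
  (Matrix.det ![S.rep, a.rep, x.rep] * Matrix.det ![S.rep, b.rep, y.rep]) /
    (Matrix.det ![S.rep, a.rep, y.rep] * Matrix.det ![S.rep, b.rep, x.rep])

/-- `Λ` is a line involution on the pencil of lines through `S` (its values at other lines are
irrelevant): it maps the pencil to itself, it is an involution, and whenever `a, Λ a`, `b, Λ b`,
`c, Λ c` are three different (unordered) pairs of conjugate lines and `l 0, l 1, l 2, l 3` are four
(distinct) lines among them in which each of the three pairs occurs, the cross-ratio of the four
lines equals that of their conjugates. -/
structure IsLineInvolution (S : ProjPoint) (Λ : ProjLine → ProjLine) : Prop where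
  mapsTo : ∀ l, OnLine S l → OnLine S (Λ l)
  involutive : ∀ l, OnLine S l → Λ (Λ l) = l
  crossRatio_eq : ∀ a b c : ProjLine, OnLine S a → OnLine S b → OnLine S c →
    ({a, Λ a} : Set ProjLine) ≠ {b, Λ b} → ({a, Λ a} : Set ProjLine) ≠ {c, Λ c} →
    ({b, Λ b} : Set ProjLine) ≠ {c, Λ c} →
    ∀ l : Fin 4 → ProjLine, Function.Injective l →
      (∀ i, l i ∈ ({a, Λ a} ∪ {b, Λ b} ∪ {c, Λ c} : Set ProjLine)) →
      (∃ i, l i ∈ ({a, Λ a} : Set ProjLine)) → (∃ i, l i ∈ ({b, Λ b} : Set ProjLine)) →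
      (∃ i, l i ∈ ({c, Λ c} : Set ProjLine)) →
      crossRatio S (l 0) (l 1) (l 2) (l 3) =
        crossRatio S (Λ (l 0)) (Λ (l 1)) (Λ (l 2)) (Λ (l 3))

/-- `SP, SP', SQ, SQ'` are four distinct lines. -/
def FourDistinctLines (S P P' Q Q' : ProjPoint) : Prop :=
  S ≠ P ∧ S ≠ P' ∧ S ≠ Q ∧ S ≠ Q' ∧ [join S P, join S P', join S Q, join S Q'].Nodup

/-- `Λ` is a line involution on the pencil of `S` for which `SP, SP'` and `SQ, SQ'` are pairs of
conjugate lines. -/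
def IsLineInvolutionGivenBy (S P P' Q Q' : ProjPoint) (Λ : ProjLine → ProjLine) : Prop :=
  IsLineInvolution S Λ ∧ Λ (join S P) = join S P' ∧ Λ (join S Q) = join S Q'

/-! ### Plane curves, tangents and the operation `P # Q` -/

/-- The point `P` lies on the curve with homogeneous equation `Γ = 0`. -/
def OnCurve (Γ : MvPolynomial (Fin 3) ℝ) (P : ProjPoint) : Prop := eval P.rep Γ = 0

/-- The gradient of `Γ` at (a representative of) `P`. -/
def gradAt (Γ : MvPolynomial (Fin 3) ℝ) (P : ProjPoint) : Fin 3 → ℝ :=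
  fun i => eval P.rep (pderiv i Γ)

/-- `P` is a nonsingular point of the curve `Γ = 0`, and `l` is the tangent of the curve there. -/
def IsTangentAt (Γ : MvPolynomial (Fin 3) ℝ) (P : ProjPoint) (l : ProjLine) : Prop :=
  OnCurve Γ P ∧ ∃ h : gradAt Γ P ≠ 0, l = Projectivization.mk ℝ (gradAt Γ P) h

/-- The intersection of the line `l` and the cubic `Γ = 0`, counted with multiplicities, is
`P + Q + R`. On the plane of vectors `x` with `l ⬝ᵥ x = 0` the linear form
`x ↦ det(l, P, x)` vanishes exactly at the multiples of `P`, so this says that the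
restriction of the cubic form to the line is a nonzero multiple of the product of the linear forms
that vanish at `P`, `Q` and `R`. -/
def LineMeetsCubicIn (Γ : MvPolynomial (Fin 3) ℝ) (l : ProjLine) (P Q R : ProjPoint) : Prop :=
  OnLine P l ∧ OnLine Q l ∧ OnLine R l ∧
    ∃ c : ℝ, c ≠ 0 ∧ ∀ x : Fin 3 → ℝ, l.rep ⬝ᵥ x = 0 →
      eval x Γ = c * (Matrix.det ![l.rep, P.rep, x] * Matrix.det ![l.rep, Q.rep, x] *
        Matrix.det ![l.rep, R.rep, x])

/-- `R = P # Q` on the cubic `Γ = 0`: the point `R` is the third intersection point, counting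
multiplicities, of the cubic with the line `PQ`, which for `P = Q` is the tangent at `P`. -/
def IsSharp (Γ : MvPolynomial (Fin 3) ℝ) (P Q R : ProjPoint) : Prop :=
  ∃ l : ProjLine, (P = Q → IsTangentAt Γ P l) ∧ LineMeetsCubicIn Γ l P Q R

end

/-! ### Vectors in three-dimensional space -/

/-! The cubic is the Jacobian curve `det(N₀x, N₁x, N₂x)` of a net of polarities for which the three
given pairs are conjugate. In coordinates with triangle of reference `ABC`, the nine points
determine the cubic form up to a factor, and that form is the Jacobian of an explicit net
(`exists_cubic_form_eq`, `exists_isJacobian`). By Hesse's theorem on complete quadrilaterals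
(`hesse`), each Schroeter step produces another pair that is conjugate for the whole net. Points
with a conjugate partner lie on the cubic; they are nonsingular because a line through a singular
point of an irreducible cubic meets it in at most one further point.

If `p, p'` are conjugate, the vectors `Nᵢp` are all orthogonal to `p'`, so some polarity `W` of the
net kills `p`; suitably scaled, it sends `p'` to the gradient at `p` (`IsJacobian.exists_netForm`).
`W` has rank 2: otherwise its singular line would meet all three given pairs (`not_onLine_triple`).
Conjugacy for `W` is therefore a line involution on the pencil of `P`. It exchanges `PQ` and `PQ'`
for every conjugate pair `Q, Q'`, and it sends `PP'` to the tangent at `P`. Two pairs of lines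
determine a line involution (`IsLineInvolution.eq_of_eq`), which identifies every involution in the
statement with this one. Counting among six disjoint pairs shows that suitable pairs exist. Hesse's
theorem, applied to `W`, gives the conjugate line by ruler (`IsPencilForm.rulerLine_polarLine`).

For the last part, let `W'` be the polarity that is singular at `P'`. On the tangent at `P` the
Jacobian determinant splits into linear factors: two vanish at `P`, the third is the tangent at `P'`
(`IsConjPair.lineMeetsCubicIn`). Hence the two tangents meet in `P # P`, and by symmetry this point
is `P' # P'`. -/

theorem dotProduct_self_ne_zero {p : Fin 3 → ℝ} (hp : p ≠ 0) : p ⬝ᵥ p ≠ 0 :=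
  fun h => hp (dotProduct_self_eq_zero.mp h)

theorem det_eq_dotProduct_cross (u v w : Fin 3 → ℝ) :
    Matrix.det ![u, v, w] = u ⬝ᵥ (v ⨯₃ w) := (triple_product_eq_det u v w).symm

/-- A vector orthogonal to `p ⨯₃ q` is a combination of `p` and `q`. -/
theorem exists_eq_smul_add_smul {p q x : Fin 3 → ℝ} (h : p ⨯₃ q ≠ 0) (hx : x ⬝ᵥ (p ⨯₃ q) = 0) :
    ∃ s t : ℝ, x = s • p + t • q := by
  have hn := dotProduct_self_ne_zero h
  set n := p ⨯₃ q with hn'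
  have key : (n ⬝ᵥ n) • x = ((x ⨯₃ q) ⬝ᵥ n) • p + ((p ⨯₃ x) ⬝ᵥ n) • q := by
    have h2 : (n ⬝ᵥ n) • x = ((x ⨯₃ q) ⬝ᵥ n) • p + ((p ⨯₃ x) ⬝ᵥ n) • q + (x ⬝ᵥ n) • n := by
      rw [hn']
      ext i
      fin_cases i <;> simp [cross_apply, dotProduct, Fin.sum_univ_three] <;> ring
    rw [h2, hx]; simp
  refine ⟨((x ⨯₃ q) ⬝ᵥ n) / (n ⬝ᵥ n), ((p ⨯₃ x) ⬝ᵥ n) / (n ⬝ᵥ n), ?_⟩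
  have := congrArg (fun y => (n ⬝ᵥ n)⁻¹ • y) key
  simpa [smul_smul, inv_mul_cancel₀ hn, div_eq_inv_mul] using this

theorem exists_eq_smul_of_cross_eq_zero {p x : Fin 3 → ℝ} (hp : p ≠ 0) (h : x ⨯₃ p = 0) :
    ∃ c : ℝ, x = c • p := by
  have hn := dotProduct_self_ne_zero hp
  have key : (p ⬝ᵥ p) • x = (x ⬝ᵥ p) • p := by
    have h2 : (p ⬝ᵥ p) • x = (x ⬝ᵥ p) • p + p ⨯₃ (x ⨯₃ p) := by
      ext i
      fin_cases i <;> simp [cross_apply, dotProduct, Fin.sum_univ_three] <;> ring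
    rw [h2, h]; simp
  refine ⟨(x ⬝ᵥ p) / (p ⬝ᵥ p), ?_⟩
  have := congrArg (fun y => (p ⬝ᵥ p)⁻¹ • y) key
  simpa [smul_smul, inv_mul_cancel₀ hn, div_eq_inv_mul] using this

/-- A vector orthogonal to both `p` and `q` is a multiple of `p ⨯₃ q`. -/
theorem exists_eq_smul_cross {p q l : Fin 3 → ℝ} (h : p ⨯₃ q ≠ 0) (hp : p ⬝ᵥ l = 0)
    (hq : q ⬝ᵥ l = 0) : ∃ c : ℝ, l = c • (p ⨯₃ q) := by
  refine exists_eq_smul_of_cross_eq_zero h ?_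
  have : l ⨯₃ (p ⨯₃ q) = (q ⬝ᵥ l) • p - (p ⬝ᵥ l) • q := by
    ext i
    fin_cases i <;> simp [cross_apply, dotProduct, Fin.sum_univ_three] <;> ring
  rw [this, hp, hq]; simp

/-! ### Incidence in the projective plane -/

theorem onLine_iff {P : ProjPoint} {l : ProjLine} : OnLine P l ↔ P.rep ⬝ᵥ l.rep = 0 := by
  conv_lhs => rw [← P.mk_rep, ← l.mk_rep]
  exact Projectivization.orthogonal_mk _ _

theorem onLine_mk {P : ProjPoint} {v : Fin 3 → ℝ} (hv : v ≠ 0) :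
    OnLine P (Projectivization.mk ℝ v hv) ↔ P.rep ⬝ᵥ v = 0 := by
  conv_lhs => rw [← P.mk_rep]
  exact Projectivization.orthogonal_mk _ _

theorem eq_iff_cross_rep {P Q : ProjPoint} : P = Q ↔ P.rep ⨯₃ Q.rep = 0 := by
  conv_lhs => rw [← P.mk_rep, ← Q.mk_rep]
  exact Projectivization.mk_eq_mk_iff_crossProduct_eq_zero _ _

theorem cross_rep_ne_zero {P Q : ProjPoint} (h : P ≠ Q) : P.rep ⨯₃ Q.rep ≠ 0 :=
  fun h' => h (eq_iff_cross_rep.mpr h')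

theorem onLine_join_left {P Q : ProjPoint} (h : P ≠ Q) : OnLine P (join P Q) :=
  Projectivization.orthogonal_cross_left h

theorem onLine_join_right {P Q : ProjPoint} (h : P ≠ Q) : OnLine Q (join P Q) :=
  Projectivization.orthogonal_cross_right h

theorem meet_onLine_left {l m : ProjLine} (h : l ≠ m) : OnLine (meet l m) l :=
  Projectivization.cross_orthogonal_left h

theorem meet_onLine_right {l m : ProjLine} (h : l ≠ m) : OnLine (meet l m) m :=
  Projectivization.cross_orthogonal_right h

theorem line_unique {P Q : ProjPoint} {l m : ProjLine} (h : P ≠ Q) (hPl : OnLine P l)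
    (hQl : OnLine Q l) (hPm : OnLine P m) (hQm : OnLine Q m) : l = m := by
  have := Configuration.Nondegenerate.eq_or_eq (P := ProjPoint) (L := ProjLine)
    (p₁ := P) (p₂ := Q) (l₁ := l) (l₂ := m) hPl hQl hPm hQm
  exact this.resolve_left h

theorem point_unique {P Q : ProjPoint} {l m : ProjLine} (h : l ≠ m) (hPl : OnLine P l)
    (hQl : OnLine Q l) (hPm : OnLine P m) (hQm : OnLine Q m) : P = Q := by
  by_contra hne
  exact h (line_unique hne hPl hQl hPm hQm)

theorem eq_join {P Q : ProjPoint} {l : ProjLine} (h : P ≠ Q) (hP : OnLine P l) (hQ : OnLine Q l) :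
    l = join P Q :=
  line_unique h hP hQ (onLine_join_left h) (onLine_join_right h)

theorem eq_meet {P : ProjPoint} {l m : ProjLine} (h : l ≠ m) (hl : OnLine P l) (hm : OnLine P m) :
    P = meet l m :=
  point_unique h hl (meet_onLine_left h) hm (meet_onLine_right h)

theorem rep_mk_join {P Q : ProjPoint} (h : P ≠ Q) :
    ∃ c : ℝ, c ≠ 0 ∧ (join P Q).rep = c • (P.rep ⨯₃ Q.rep) := by
  obtain ⟨c, hc⟩ := exists_eq_smul_cross (cross_rep_ne_zero h)
    (onLine_iff.mp (onLine_join_left h)) (onLine_iff.mp (onLine_join_right h))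
  refine ⟨c, ?_, hc⟩
  rintro rfl
  exact (join P Q).rep_nonzero (by simpa using hc)

theorem rep_meet {l m : ProjLine} (h : l ≠ m) :
    ∃ c : ℝ, c ≠ 0 ∧ (meet l m).rep = c • (l.rep ⨯₃ m.rep) := rep_mk_join h

theorem exists_rep_eq_of_onLine {P Q X : ProjPoint} {l : ProjLine} (h : P ≠ Q) (hP : OnLine P l)
    (hQ : OnLine Q l) (hX : OnLine X l) : ∃ s t : ℝ, X.rep = s • P.rep + t • Q.rep := by
  obtain ⟨c, hc⟩ := exists_eq_smul_cross (cross_rep_ne_zero h) (onLine_iff.mp hP)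
    (onLine_iff.mp hQ)
  have hX := onLine_iff.mp hX
  have hc0 : c ≠ 0 := by
    rintro rfl
    exact l.rep_nonzero (by simpa using hc)
  rw [hc, dotProduct_smul, smul_eq_mul, mul_eq_zero] at hX
  exact exists_eq_smul_add_smul (cross_rep_ne_zero h) (hX.resolve_left hc0)

theorem exists_rep_eq_smul {P : ProjPoint} {v : Fin 3 → ℝ} (hv : v ≠ 0)
    (h : P = Projectivization.mk ℝ v hv) : ∃ c : ℝ, c ≠ 0 ∧ P.rep = c • v := by
  obtain ⟨a, ha⟩ := Projectivization.exists_smul_eq_mk_rep ℝ v hv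
  exact ⟨a, a.ne_zero, by rw [h, ← ha]; rfl⟩

theorem rep_eq_smul_add_smul_ne_zero {P Q X : ProjPoint} {s t : ℝ}
    (h : X.rep = s • P.rep + t • Q.rep) (hQ : X ≠ Q) : s ≠ 0 := by
  rintro rfl
  refine hQ (eq_iff_cross_rep.mpr ?_)
  rw [h]
  simp

/-! ### Plane cubics -/

theorem exists_cubic_coefficients {Γ : MvPolynomial (Fin 3) ℝ} (h : Γ.IsHomogeneous 3) :
    ∃ g : Fin 10 → ℝ, Γ = C (g 0) * X 0 ^ 3 + C (g 1) * X 1 ^ 3 + C (g 2) * X 2 ^ 3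
      + C (g 3) * (X 0 ^ 2 * X 1) + C (g 4) * (X 0 * X 1 ^ 2) + C (g 5) * (X 1 ^ 2 * X 2)
      + C (g 6) * (X 1 * X 2 ^ 2) + C (g 7) * (X 2 ^ 2 * X 0) + C (g 8) * (X 2 * X 0 ^ 2)
      + C (g 9) * (X 0 * X 1 * X 2) := by
  rw [← Γ.support_sum_monomial_coeff]
  refine Finset.sum_induction _ (fun Δ => ∃ g : Fin 10 → ℝ, Δ = C (g 0) * X 0 ^ 3
      + C (g 1) * X 1 ^ 3 + C (g 2) * X 2 ^ 3
      + C (g 3) * (X 0 ^ 2 * X 1) + C (g 4) * (X 0 * X 1 ^ 2) + C (g 5) * (X 1 ^ 2 * X 2)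
      + C (g 6) * (X 1 * X 2 ^ 2) + C (g 7) * (X 2 ^ 2 * X 0) + C (g 8) * (X 2 * X 0 ^ 2)
      + C (g 9) * (X 0 * X 1 * X 2)) ?_ ?_ ?_
  · rintro _ _ ⟨g, rfl⟩ ⟨g', rfl⟩
    refine ⟨g + g', ?_⟩
    simp only [Pi.add_apply, map_add]
    ring
  · exact ⟨0, by simp⟩
  · intro d hd
    have hdeg : d 0 + d 1 + d 2 = 3 := by
      have := h (mem_support_iff.mp hd)
      simpa [Finsupp.weight_apply, Finsupp.sum_fintype, Fin.sum_univ_three] using this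
    have hmon : monomial d (coeff d Γ) = C (coeff d Γ) * (X 0 ^ d 0 * X 1 ^ d 1 * X 2 ^ d 2) := by
      rw [monomial_eq, Finsupp.prod_fintype _ _ (by simp), Fin.prod_univ_three]
    rw [hmon]
    generalize coeff d Γ = c
    have pick : ∀ (i : Fin 10), ∃ g : Fin 10 → ℝ, g i = c ∧ ∀ j, j ≠ i → g j = 0 :=
      fun i => ⟨Pi.single i c, by simp, fun j hj => by simp [hj]⟩
    have finish : ∀ a b e : ℕ, a + b + e = 3 → ∃ i : Fin 10, ∀ g : Fin 10 → ℝ,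
        g i = c → (∀ j, j ≠ i → g j = 0) →
        C c * (X 0 ^ a * X 1 ^ b * X 2 ^ e) = C (g 0) * (X 0 : MvPolynomial (Fin 3) ℝ) ^ 3
          + C (g 1) * X 1 ^ 3 + C (g 2) * X 2 ^ 3
          + C (g 3) * (X 0 ^ 2 * X 1) + C (g 4) * (X 0 * X 1 ^ 2) + C (g 5) * (X 1 ^ 2 * X 2)
          + C (g 6) * (X 1 * X 2 ^ 2) + C (g 7) * (X 2 ^ 2 * X 0) + C (g 8) * (X 2 * X 0 ^ 2)
          + C (g 9) * (X 0 * X 1 * X 2) := by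
      intro a b e habe
      have ha : a ≤ 3 := by omega
      have hb : b ≤ 3 := by omega
      obtain rfl : e = 3 - a - b := by omega
      interval_cases a <;> interval_cases b <;> try omega
      -- The exponents `(a, b, e)` occur in lexicographic order from `(0, 0, 3)` to `(3, 0, 0)`;
      -- each entry is the index of the coefficient of that monomial.
      exacts [⟨2, fun g hg hg' => by simp [hg, hg']⟩,
        ⟨6, fun g hg hg' => by simp [hg, hg']⟩,
        ⟨5, fun g hg hg' => by simp [hg, hg']⟩,
        ⟨1, fun g hg hg' => by simp [hg, hg']⟩,
        ⟨7, fun g hg hg' => by simp [hg, hg', mul_comm]⟩,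
        ⟨9, fun g hg hg' => by simp [hg, hg', mul_comm]⟩,
        ⟨4, fun g hg hg' => by simp [hg, hg']⟩,
        ⟨8, fun g hg hg' => by simp [hg, hg', mul_comm]⟩,
        ⟨3, fun g hg hg' => by simp [hg, hg']⟩,
        ⟨0, fun g hg hg' => by simp [hg, hg']⟩]
    obtain ⟨i, hi⟩ := finish _ _ _ hdeg
    obtain ⟨g, hg, hg'⟩ := pick i
    exact ⟨g, hi g hg hg'⟩

/-- The gradient of a polynomial at a vector. -/
noncomputable def grad (Γ : MvPolynomial (Fin 3) ℝ) (p : Fin 3 → ℝ) : Fin 3 → ℝ :=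
  fun i => eval p (pderiv i Γ)

theorem eval_smul_add_smul {Γ : MvPolynomial (Fin 3) ℝ} (h : Γ.IsHomogeneous 3) (s t : ℝ)
    (p q : Fin 3 → ℝ) :
    eval (s • p + t • q) Γ = s ^ 3 * eval p Γ + s ^ 2 * t * (grad Γ p ⬝ᵥ q)
      + s * t ^ 2 * (grad Γ q ⬝ᵥ p) + t ^ 3 * eval q Γ := by
  obtain ⟨g, rfl⟩ := exists_cubic_coefficients h
  simp [grad, dotProduct, Fin.sum_univ_three, pderiv_X, Pi.single_apply]
  ring

theorem exists_eval_smul_add_smul_add_smul {Γ : MvPolynomial (Fin 3) ℝ} (h : Γ.IsHomogeneous 3)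
    (a b c : Fin 3 → ℝ) :
    ∃ m : ℝ, ∀ x y z : ℝ, eval (x • a + y • b + z • c) Γ =
      x ^ 3 * eval a Γ + y ^ 3 * eval b Γ + z ^ 3 * eval c Γ
      + x ^ 2 * y * (grad Γ a ⬝ᵥ b) + x * y ^ 2 * (grad Γ b ⬝ᵥ a)
      + y ^ 2 * z * (grad Γ b ⬝ᵥ c) + y * z ^ 2 * (grad Γ c ⬝ᵥ b)
      + z ^ 2 * x * (grad Γ c ⬝ᵥ a) + z * x ^ 2 * (grad Γ a ⬝ᵥ c) + x * y * z * m := by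
  obtain ⟨g, rfl⟩ := exists_cubic_coefficients h
  -- Six times the symmetric trilinear form of `Γ` at `a, b, c`.
  refine ⟨6 * g 0 * a 0 * b 0 * c 0 + 6 * g 1 * a 1 * b 1 * c 1 + 6 * g 2 * a 2 * b 2 * c 2
    + 2 * g 3 * (a 0 * b 0 * c 1 + a 0 * b 1 * c 0 + a 1 * b 0 * c 0)
    + 2 * g 4 * (a 0 * b 1 * c 1 + a 1 * b 0 * c 1 + a 1 * b 1 * c 0)
    + 2 * g 5 * (a 1 * b 1 * c 2 + a 1 * b 2 * c 1 + a 2 * b 1 * c 1)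
    + 2 * g 6 * (a 1 * b 2 * c 2 + a 2 * b 1 * c 2 + a 2 * b 2 * c 1)
    + 2 * g 7 * (a 2 * b 2 * c 0 + a 2 * b 0 * c 2 + a 0 * b 2 * c 2)
    + 2 * g 8 * (a 2 * b 0 * c 0 + a 0 * b 2 * c 0 + a 0 * b 0 * c 2)
    + g 9 * (a 0 * b 1 * c 2 + a 0 * b 2 * c 1 + a 1 * b 0 * c 2 + a 1 * b 2 * c 0
      + a 2 * b 0 * c 1 + a 2 * b 1 * c 0), fun x y z => ?_⟩
  simp [grad, dotProduct, Fin.sum_univ_three, pderiv_X, Pi.single_apply]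
  ring

/-- An irreducible cubic contains no line. -/
theorem exists_eval_ne_zero_of_irreducible {Γ : MvPolynomial (Fin 3) ℝ} (h : Γ.IsHomogeneous 3)
    (hirr : Irreducible Γ) {u : Fin 3 → ℝ} (hu : u ≠ 0) :
    ∃ x : Fin 3 → ℝ, u ⬝ᵥ x = 0 ∧ eval x Γ ≠ 0 := by
  by_contra! hcon
  obtain ⟨i, hi⟩ := Function.ne_iff.mp hu
  rw [Pi.zero_apply] at hi
  set ℓ : MvPolynomial (Fin 3) ℝ := ∑ j, C (u j) * X j with hℓ
  have hevalℓ : ∀ x, eval x ℓ = u ⬝ᵥ x := fun x => by simp [hℓ, dotProduct]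
  -- This substitution solves `ℓ = 0` for `X i`: it is the identity modulo `ℓ` and has its values on
  -- the line, so a cubic that vanishes on the line is sent to zero and is divisible by `ℓ`.
  let φ : Fin 3 → MvPolynomial (Fin 3) ℝ := fun j => X j - if j = i then C (u i)⁻¹ * ℓ else 0
  have hsub : ∀ p : MvPolynomial (Fin 3) ℝ, ℓ ∣ p - aeval φ p := by
    intro p
    induction p using MvPolynomial.induction_on with
    | C a => simp
    | add p q hp hq =>
      rw [map_add, add_sub_add_comm]
      exact dvd_add hp hq
    | mul_X p j hp =>
      have hj : ℓ ∣ X j - φ j := by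
        simp only [φ, sub_sub_cancel]
        split_ifs
        · exact dvd_mul_left _ _
        · exact dvd_zero _
      have : p * X j - aeval φ (p * X j) = (p - aeval φ p) * X j + aeval φ p * (X j - φ j) := by
        rw [map_mul, aeval_X]; ring
      rw [this]
      exact dvd_add (hp.mul_right _) (hj.mul_left _)
  have hzero : aeval φ Γ = 0 := by
    refine MvPolynomial.funext fun x => ?_
    have hev : eval x (aeval φ Γ) = eval (fun j => eval x (φ j)) Γ := by
      simpa [aeval_eq_eval] using aeval_bind₁ x φ Γ
    rw [hev, map_zero]
    apply hcon
    have : ∀ j, eval x (φ j) = x j - if j = i then (u i)⁻¹ * (u ⬝ᵥ x) else 0 := by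
      intro j
      simp only [φ]
      split_ifs <;> simp [hevalℓ]
    simp only [dotProduct, this, mul_sub, Finset.sum_sub_distrib, mul_ite, mul_zero,
      Finset.sum_ite_eq', Finset.mem_univ, if_true]
    rw [← mul_assoc, mul_inv_cancel₀ hi, one_mul, sub_self]
  obtain ⟨q, hq⟩ : ℓ ∣ Γ := by
    have := hsub Γ
    rwa [hzero, sub_zero] at this
  rcases hirr.isUnit_or_isUnit hq with hunit | hunit
  · have := (hunit.map (eval (0 : Fin 3 → ℝ))).ne_zero
    rw [hevalℓ] at this
    simp at this
  · obtain ⟨c, hc, rfl⟩ := (MvPolynomial.isUnit_iff_eq_C_of_isReduced).mp hunit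
    -- If the cofactor is constant, `Γ` is a linear form; doubling the argument then multiplies the
    -- value both by 8 and by 2.
    have h1 := eval_smul_add_smul h 2 0 (Pi.single i 1) 0
    have h2 : eval ((2 : ℝ) • Pi.single i (1 : ℝ) + (0 : ℝ) • (0 : Fin 3 → ℝ)) Γ = 2 * (u i * c) := by
      rw [hq, map_mul, hevalℓ, eval_C]
      simp; ring
    have h3 : eval (Pi.single i (1 : ℝ)) Γ = u i * c := by
      rw [hq, map_mul, hevalℓ, eval_C]
      simp
    rw [h2, h3] at h1
    have : u i * c = 0 := by linarith
    exact mul_ne_zero hi hc.ne_zero this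

/-- For `P`, `Q` on the curve, the cubic at `sP + tQ` is `st` times a linear form in `s, t` whose
coefficients are these two gradient values. If both vanish, the cubic contains the line `PQ`. -/
theorem false_of_gradAt_dotProduct_eq_zero {Γ : MvPolynomial (Fin 3) ℝ} (h : Γ.IsHomogeneous 3)
    (hirr : Irreducible Γ) {P Q : ProjPoint} (hPQ : P ≠ Q) (hP : OnCurve Γ P) (hQ : OnCurve Γ Q)
    (h1 : gradAt Γ P ⬝ᵥ Q.rep = 0) (h2 : gradAt Γ Q ⬝ᵥ P.rep = 0) : False := by
  obtain ⟨x, hx, hne⟩ := exists_eval_ne_zero_of_irreducible h hirr (cross_rep_ne_zero hPQ)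
  rw [dotProduct_comm] at hx
  obtain ⟨s, t, rfl⟩ := exists_eq_smul_add_smul (cross_rep_ne_zero hPQ) hx
  refine hne ?_
  have h1' : grad Γ P.rep ⬝ᵥ Q.rep = 0 := h1
  have h2' : grad Γ Q.rep ⬝ᵥ P.rep = 0 := h2
  rw [eval_smul_add_smul h, h1', h2', show eval P.rep Γ = 0 from hP, show eval Q.rep Γ = 0 from hQ]
  ring

/-- The relation satisfied by the third intersection point of a cubic with a line. -/
theorem third_point_relation {Γ : MvPolynomial (Fin 3) ℝ} (h : Γ.IsHomogeneous 3)
    {P Q X : ProjPoint} {s t : ℝ} (hX : X.rep = s • P.rep + t • Q.rep) (hs : s ≠ 0) (ht : t ≠ 0)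
    (hP : OnCurve Γ P) (hQ : OnCurve Γ Q) (hXΓ : OnCurve Γ X) :
    s * (gradAt Γ P ⬝ᵥ Q.rep) + t * (gradAt Γ Q ⬝ᵥ P.rep) = 0 := by
  have e := eval_smul_add_smul h s t P.rep Q.rep
  rw [← hX, show eval P.rep Γ = 0 from hP, show eval Q.rep Γ = 0 from hQ,
    show eval X.rep Γ = 0 from hXΓ] at e
  have : (s * t) * (s * (gradAt Γ P ⬝ᵥ Q.rep) + t * (gradAt Γ Q ⬝ᵥ P.rep)) = 0 := by
    change (s * t) * (s * (grad Γ P.rep ⬝ᵥ Q.rep) + t * (grad Γ Q.rep ⬝ᵥ P.rep)) = 0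
    linarith
  exact (mul_eq_zero.mp this).resolve_left (mul_ne_zero hs ht)

/-- A line meets an irreducible cubic in at most three points. -/
theorem false_of_four_points {Γ : MvPolynomial (Fin 3) ℝ} (h : Γ.IsHomogeneous 3)
    (hirr : Irreducible Γ) {l : ProjLine} {P Q X Y : ProjPoint} (hnd : [P, Q, X, Y].Nodup)
    (hP : OnCurve Γ P) (hQ : OnCurve Γ Q) (hX : OnCurve Γ X) (hY : OnCurve Γ Y)
    (hPl : OnLine P l) (hQl : OnLine Q l) (hXl : OnLine X l) (hYl : OnLine Y l) : False := by
  simp only [List.nodup_cons, List.mem_cons, List.not_mem_nil, or_false, not_or, not_false_eq_true,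
    List.nodup_nil, and_true] at hnd
  obtain ⟨⟨hPQ, hPX, hPY⟩, ⟨hQX, hQY⟩, hXY⟩ := hnd
  obtain ⟨s, t, hst⟩ := exists_rep_eq_of_onLine hPQ hPl hQl hXl
  obtain ⟨s', t', hst'⟩ := exists_rep_eq_of_onLine hPQ hPl hQl hYl
  have r1 := third_point_relation h hst (rep_eq_smul_add_smul_ne_zero hst (Ne.symm hQX))
    (rep_eq_smul_add_smul_ne_zero (hst.trans (add_comm _ _)) (Ne.symm hPX)) hP hQ hX
  have r2 := third_point_relation h hst' (rep_eq_smul_add_smul_ne_zero hst' (Ne.symm hQY))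
    (rep_eq_smul_add_smul_ne_zero (hst'.trans (add_comm _ _)) (Ne.symm hPY)) hP hQ hY
  -- The relations for `X` and `Y` form a homogeneous linear system in the two mixed gradient
  -- values, and its determinant is nonzero because `X ≠ Y`.
  have hdet : s * t' - s' * t ≠ 0 := by
    intro h0
    refine hXY (eq_iff_cross_rep.mpr ?_)
    have : X.rep ⨯₃ Y.rep = (s * t' - s' * t) • (P.rep ⨯₃ Q.rep) := by
      rw [hst, hst']
      ext i
      fin_cases i <;> simp [cross_apply] <;> ring
    rw [this, h0, zero_smul]
  refine false_of_gradAt_dotProduct_eq_zero h hirr hPQ hP hQ ?_ ?_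
  · refine (mul_eq_zero.mp ?_).resolve_left hdet
    linear_combination t' * r1 - t * r2
  · refine (mul_eq_zero.mp ?_).resolve_left hdet
    linear_combination s * r2 - s' * r1

/-- A point of an irreducible cubic that is collinear with two further points is nonsingular. -/
theorem gradAt_ne_zero_of_three_points {Γ : MvPolynomial (Fin 3) ℝ} (h : Γ.IsHomogeneous 3)
    (hirr : Irreducible Γ) {l : ProjLine} {P Q X : ProjPoint} (hPQ : P ≠ Q) (hPX : P ≠ X)
    (hQX : Q ≠ X) (hP : OnCurve Γ P) (hQ : OnCurve Γ Q) (hX : OnCurve Γ X)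
    (hPl : OnLine P l) (hQl : OnLine Q l) (hXl : OnLine X l) : gradAt Γ P ≠ 0 := by
  intro h0
  obtain ⟨s, t, hst⟩ := exists_rep_eq_of_onLine hPQ hPl hQl hXl
  have ht := rep_eq_smul_add_smul_ne_zero (hst.trans (add_comm _ _)) (Ne.symm hPX)
  have r1 := third_point_relation h hst (rep_eq_smul_add_smul_ne_zero hst (Ne.symm hQX))
    ht hP hQ hX
  rw [h0, zero_dotProduct, mul_zero, zero_add, mul_eq_zero] at r1
  exact false_of_gradAt_dotProduct_eq_zero h hirr hPQ hP hQ (by rw [h0, zero_dotProduct]) (r1.resolve_left ht)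

/-! ### The net of polarities of a cubic -/

/-- `x` and `y` are conjugate with respect to all polarities of the net spanned by `N`. -/
def Conj (N : Fin 3 → Matrix (Fin 3) (Fin 3) ℝ) (x y : Fin 3 → ℝ) : Prop :=
  ∀ i, x ⬝ᵥ N i *ᵥ y = 0

/-- The cubic `Γ` is the Jacobian curve of the net of polarities spanned by `N`. -/
structure IsJacobian (Γ : MvPolynomial (Fin 3) ℝ) (N : Fin 3 → Matrix (Fin 3) (Fin 3) ℝ) :
    Prop where
  isSymm : ∀ i, (N i).IsSymm
  eval_eq : ∀ x, eval x Γ = Matrix.det ![N 0 *ᵥ x, N 1 *ᵥ x, N 2 *ᵥ x]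

theorem det_vecMul (u v w : Fin 3 → ℝ) (G : Matrix (Fin 3) (Fin 3) ℝ) :
    Matrix.det ![u ᵥ* G, v ᵥ* G, w ᵥ* G] = Matrix.det ![u, v, w] * G.det := by
  refine (congrArg Matrix.det (?_ : _ = Matrix.of ![u, v, w] * G)).trans (Matrix.det_mul _ _)
  ext i j
  fin_cases i <;> rfl

theorem exists_eq_mul_of_two_relations {s t p q u v : ℝ} (ht : t ≠ 0) (hu : u ≠ 0)
    (h1 : s * p + t * q = 0) (h2 : s * u + t * v = 0) : ∃ k, p = k * u ∧ q = k * v := by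
  refine ⟨p / u, by field_simp, ?_⟩
  have : t * (q * u) = t * (p * v) := by linear_combination u * h1 - p * h2
  have := mul_left_cancel₀ ht this
  field_simp
  exact this

/-- The cubic form with the prescribed zeros, in coordinates for which `A`, `B`, `C` are the
vertices of the triangle of reference. -/
theorem exists_cubic_form_eq {a b c : Fin 3 → ℝ} {f : ℝ → ℝ → ℝ → ℝ} {l μ ν m : ℝ}
    (hf : ∀ x y z, f x y z =
      l * (x * y * ((a 1 * b 2 - a 2 * b 1) * x + (a 2 * b 0 - a 0 * b 2) * y))
      + μ * (y * z * ((b 2 * c 0 - b 0 * c 2) * y + (b 0 * c 1 - b 1 * c 0) * z))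
      + ν * (z * x * ((c 0 * a 1 - c 1 * a 0) * z + (c 1 * a 2 - c 2 * a 1) * x))
      + m * (x * y * z))
    (hδ : a ⬝ᵥ (b ⨯₃ c) ≠ 0) (ha : f (a 0) (a 1) (a 2) = 0) (hb : f (b 0) (b 1) (b 2) = 0)
    (hc : f (c 0) (c 1) (c 2) = 0) (ha1 : a 1 ≠ 0) (ha2 : a 2 ≠ 0) (hb0 : b 0 ≠ 0) (hb2 : b 2 ≠ 0)
    (hc0 : c 0 ≠ 0) (hc1 : c 1 ≠ 0) :
    ∃ k, ∀ x y z, f x y z =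
      k * ((a 0 * y - a 1 * x) * (b 1 * z - b 2 * y) * (c 2 * x - c 0 * z)
        + (a 0 * z - a 2 * x) * (b 1 * x - b 0 * y) * (c 2 * y - c 1 * z)) := by
  set δ := a ⬝ᵥ (b ⨯₃ c) with hδ'
  simp only [cross_apply, dotProduct, Fin.sum_univ_three, Matrix.cons_val] at hδ'
  -- Completing the three linear factors to the full equations of `A'B'`, `B'C'`, `C'A'` leaves `k₀
  -- * x * y * z`. At each of `A'`, `B'`, `C'` two of these lines vanish, so only one relation
  -- between `k₀` and one of `l`, `μ`, `ν` remains.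
  set k₀ := m - l * (a 0 * b 1 - a 1 * b 0) - μ * (b 1 * c 2 - b 2 * c 1)
    - ν * (c 2 * a 0 - c 0 * a 2) with hk₀
  have e1 : μ * δ + k₀ * a 0 = 0 := by
    rw [hf] at ha
    refine (mul_eq_zero.mp (?_ : (a 1 * a 2) * _ = 0)).resolve_left (mul_ne_zero ha1 ha2)
    rw [hδ', hk₀]
    linear_combination ha
  have e2 : ν * δ + k₀ * b 1 = 0 := by
    rw [hf] at hb
    refine (mul_eq_zero.mp (?_ : (b 0 * b 2) * _ = 0)).resolve_left (mul_ne_zero hb0 hb2)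
    rw [hδ', hk₀]
    linear_combination hb
  have e3 : l * δ + k₀ * c 2 = 0 := by
    rw [hf] at hc
    refine (mul_eq_zero.mp (?_ : (c 0 * c 1) * _ = 0)).resolve_left (mul_ne_zero hc0 hc1)
    rw [hδ', hk₀]
    linear_combination hc
  obtain ⟨k, hk⟩ : ∃ k, δ * k = -k₀ := ⟨-k₀ / δ, by field_simp⟩
  have e1' : μ = k * a 0 := mul_left_cancel₀ hδ (by linear_combination e1 - a 0 * hk)
  have e2' : ν = k * b 1 := mul_left_cancel₀ hδ (by linear_combination e2 - b 1 * hk)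
  have e3' : l = k * c 2 := mul_left_cancel₀ hδ (by linear_combination e3 - c 2 * hk)
  refine ⟨k, fun x y z => ?_⟩
  have hm : m = l * (a 0 * b 1 - a 1 * b 0) + μ * (b 1 * c 2 - b 2 * c 1)
    + ν * (c 2 * a 0 - c 0 * a 2) - δ * k := by linear_combination hk - hk₀
  rw [hf, hm, e1', e2', e3', hδ']
  ring

/-- A cubic through `A`, `A'`, `B`, `B'`, `C`, `C'` and the third intersection points `D`, `E`, `F`
is the Jacobian curve of a net of polarities for which `A, A'`, `B, B'` and `C, C'` are
conjugate. -/
theorem exists_isJacobian {Γ : MvPolynomial (Fin 3) ℝ} (h : Γ.IsHomogeneous 3)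
    {a b c a' b' c' d e f : Fin 3 → ℝ}
    (ha : eval a Γ = 0) (hb : eval b Γ = 0) (hc : eval c Γ = 0)
    (ha' : eval a' Γ = 0) (hb' : eval b' Γ = 0) (hc' : eval c' Γ = 0)
    (hΔ : a ⬝ᵥ (b ⨯₃ c) ≠ 0) (hδ : a' ⬝ᵥ (b' ⨯₃ c') ≠ 0)
    (ha0 : a' ⬝ᵥ (b ⨯₃ c) ≠ 0) (ha1 : a' ⬝ᵥ (c ⨯₃ a) ≠ 0) (ha2 : a' ⬝ᵥ (a ⨯₃ b) ≠ 0)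
    (hb0 : b' ⬝ᵥ (b ⨯₃ c) ≠ 0) (hb1 : b' ⬝ᵥ (c ⨯₃ a) ≠ 0) (hb2 : b' ⬝ᵥ (a ⨯₃ b) ≠ 0)
    (hc0 : c' ⬝ᵥ (b ⨯₃ c) ≠ 0) (hc1 : c' ⬝ᵥ (c ⨯₃ a) ≠ 0) (hc2 : c' ⬝ᵥ (a ⨯₃ b) ≠ 0)
    (hγ : a ⬝ᵥ (a' ⨯₃ b') ≠ 0) (hα : b ⬝ᵥ (b' ⨯₃ c') ≠ 0) (hβ : c ⬝ᵥ (c' ⨯₃ a') ≠ 0)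
    {s t s₁ t₁ s₂ t₂ : ℝ} (ht : t ≠ 0) (ht₁ : t₁ ≠ 0) (ht₂ : t₂ ≠ 0)
    (hd : d = s • a + t • b) (he : e = s₁ • b + t₁ • c) (hf : f = s₂ • c + t₂ • a)
    (hd' : d ⬝ᵥ (a' ⨯₃ b') = 0) (he' : e ⬝ᵥ (b' ⨯₃ c') = 0) (hf' : f ⬝ᵥ (c' ⨯₃ a') = 0)
    (hdΓ : s * (grad Γ a ⬝ᵥ b) + t * (grad Γ b ⬝ᵥ a) = 0)
    (heΓ : s₁ * (grad Γ b ⬝ᵥ c) + t₁ * (grad Γ c ⬝ᵥ b) = 0)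
    (hfΓ : s₂ * (grad Γ c ⬝ᵥ a) + t₂ * (grad Γ a ⬝ᵥ c) = 0) :
    ∃ N, IsJacobian Γ N ∧ Conj N a a' ∧ Conj N b b' ∧ Conj N c c' := by
  -- The columns are `a, b, c`, so `G = M⁻¹` gives the coordinates relative to the triangle `ABC`.
  set M : Matrix (Fin 3) (Fin 3) ℝ := (Matrix.of ![a, b, c])ᵀ with hM
  have hMv : ∀ v, M *ᵥ v = v 0 • a + v 1 • b + v 2 • c := by
    intro v
    ext i
    simp [hM, Matrix.mulVec, dotProduct, Fin.sum_univ_three, mul_comm]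
  have hdet : M.det = a ⬝ᵥ (b ⨯₃ c) := by
    rw [hM, Matrix.det_transpose, det_eq_dotProduct_cross a b c |>.symm]; rfl
  have hunit : IsUnit M.det := by rw [hdet]; exact hΔ.isUnit
  set G := M⁻¹ with hG
  have hMG : ∀ v, M *ᵥ (G *ᵥ v) = v := fun v => by
    rw [Matrix.mulVec_mulVec, Matrix.mul_nonsing_inv _ hunit, Matrix.one_mulVec]
  have hGM : ∀ v, G *ᵥ (M *ᵥ v) = v := fun v => by
    rw [Matrix.mulVec_mulVec, Matrix.nonsing_inv_mul _ hunit, Matrix.one_mulVec]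
  have hGa : G *ᵥ a = Pi.single 0 1 := by
    rw [← hGM (Pi.single 0 1), hMv]; simp
  have hGb : G *ᵥ b = Pi.single 1 1 := by
    rw [← hGM (Pi.single 1 1), hMv]; simp
  have hGc : G *ᵥ c = Pi.single 2 1 := by
    rw [← hGM (Pi.single 2 1), hMv]; simp
  have hco : ∀ v, v = (G *ᵥ v) 0 • a + (G *ᵥ v) 1 • b + (G *ᵥ v) 2 • c := fun v => by
    rw [← hMv, hMG]
  have c0 : ∀ v, v ⬝ᵥ (b ⨯₃ c) = (G *ᵥ v) 0 * a ⬝ᵥ (b ⨯₃ c) := fun v => by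
    conv_lhs => rw [hco v]
    simp [add_dotProduct]
  have c1 : ∀ v, v ⬝ᵥ (c ⨯₃ a) = (G *ᵥ v) 1 * a ⬝ᵥ (b ⨯₃ c) := fun v => by
    conv_lhs => rw [hco v]
    simp [add_dotProduct, triple_product_permutation a b c]
  have c2 : ∀ v, v ⬝ᵥ (a ⨯₃ b) = (G *ᵥ v) 2 * a ⬝ᵥ (b ⨯₃ c) := fun v => by
    conv_lhs => rw [hco v]
    simp [add_dotProduct, triple_product_permutation c a b]
  have ctriple : ∀ u v w, u ⬝ᵥ (v ⨯₃ w) =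
      ((G *ᵥ u) ⬝ᵥ ((G *ᵥ v) ⨯₃ (G *ᵥ w))) * a ⬝ᵥ (b ⨯₃ c) := by
    intro u v w
    conv_lhs => rw [hco u, hco v, hco w]
    generalize G *ᵥ u = x
    generalize G *ᵥ v = y
    generalize G *ᵥ w = z
    simp [cross_apply, dotProduct, Fin.sum_univ_three]
    ring
  rw [c0] at ha0 hb0 hc0
  rw [c1] at ha1 hb1 hc1
  rw [c2] at ha2 hb2 hc2
  rw [ctriple] at hδ hγ hα hβ hd' he' hf'
  have hGd : G *ᵥ d = s • Pi.single 0 1 + t • Pi.single 1 1 := by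
    rw [hd, Matrix.mulVec_add, Matrix.mulVec_smul, Matrix.mulVec_smul, hGa, hGb]
  have hGe : G *ᵥ e = s₁ • Pi.single 1 1 + t₁ • Pi.single 2 1 := by
    rw [he, Matrix.mulVec_add, Matrix.mulVec_smul, Matrix.mulVec_smul, hGb, hGc]
  have hGf : G *ᵥ f = s₂ • Pi.single 2 1 + t₂ • Pi.single 0 1 := by
    rw [hf, Matrix.mulVec_add, Matrix.mulVec_smul, Matrix.mulVec_smul, hGc, hGa]
  rw [hGd] at hd'
  rw [hGe] at he'
  rw [hGf] at hf'
  rw [hGa] at hγ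
  rw [hGb] at hα
  rw [hGc] at hβ
  replace hd' := (mul_eq_zero.mp hd').resolve_right hΔ
  replace he' := (mul_eq_zero.mp he').resolve_right hΔ
  replace hf' := (mul_eq_zero.mp hf').resolve_right hΔ
  replace hγ := left_ne_zero_of_mul hγ
  replace hα := left_ne_zero_of_mul hα
  replace hβ := left_ne_zero_of_mul hβ
  replace hδ := left_ne_zero_of_mul hδ
  replace ha0 := left_ne_zero_of_mul ha0
  replace ha1 := left_ne_zero_of_mul ha1
  replace ha2 := left_ne_zero_of_mul ha2
  replace hb0 := left_ne_zero_of_mul hb0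
  replace hb1 := left_ne_zero_of_mul hb1
  replace hb2 := left_ne_zero_of_mul hb2
  replace hc0 := left_ne_zero_of_mul hc0
  replace hc1 := left_ne_zero_of_mul hc1
  replace hc2 := left_ne_zero_of_mul hc2
  obtain ⟨m, hm⟩ := exists_eval_smul_add_smul_add_smul h a b c
  rw [ha, hb, hc] at hm
  rw [hco a'] at ha'
  rw [hco b'] at hb'
  rw [hco c'] at hc'
  have hd'' : s * ((G *ᵥ a') 1 * (G *ᵥ b') 2 - (G *ᵥ a') 2 * (G *ᵥ b') 1)
      + t * ((G *ᵥ a') 2 * (G *ᵥ b') 0 - (G *ᵥ a') 0 * (G *ᵥ b') 2) = 0 := by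
    simpa [cross_apply] using hd'
  have he'' : s₁ * ((G *ᵥ b') 2 * (G *ᵥ c') 0 - (G *ᵥ b') 0 * (G *ᵥ c') 2)
      + t₁ * ((G *ᵥ b') 0 * (G *ᵥ c') 1 - (G *ᵥ b') 1 * (G *ᵥ c') 0) = 0 := by
    simpa [cross_apply] using he'
  have hf'' : s₂ * ((G *ᵥ c') 0 * (G *ᵥ a') 1 - (G *ᵥ c') 1 * (G *ᵥ a') 0)
      + t₂ * ((G *ᵥ c') 1 * (G *ᵥ a') 2 - (G *ᵥ c') 2 * (G *ᵥ a') 1) = 0 := by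
    simpa [cross_apply] using hf'
  -- On the side `AB` the cubic is `xy` times a linear form that vanishes at `D`. The line `A'B'`
  -- also vanishes at `D`, so the two forms are proportional there; likewise on the other sides.
  obtain ⟨l, hl, hl'⟩ := exists_eq_mul_of_two_relations ht (by simpa [cross_apply] using hγ) hdΓ hd''
  obtain ⟨μ, hμ, hμ'⟩ := exists_eq_mul_of_two_relations ht₁ (by simpa [cross_apply] using hα) heΓ he''
  obtain ⟨ν, hν, hν'⟩ := exists_eq_mul_of_two_relations ht₂ (by simpa [cross_apply] using hβ) hfΓ hf''
  obtain ⟨k, hk⟩ := exists_cubic_form_eq (a := G *ᵥ a') (b := G *ᵥ b') (c := G *ᵥ c')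
    (f := fun x y z => eval (x • a + y • b + z • c) Γ) (l := l) (μ := μ) (ν := ν) (m := m)
    (fun x y z => by rw [hm, hl, hl', hμ, hμ', hν, hν']; ring) hδ ha' hb' hc' ha1 ha2 hb0 hb2 hc0 hc1
  have hGdet : G.det ≠ 0 := (Matrix.isUnit_nonsing_inv_det M hunit).ne_zero
  clear_value G
  clear ha' hb' hc'
  generalize hA : G *ᵥ a' = A at *
  generalize hB : G *ᵥ b' = B at *
  generalize hC : G *ᵥ c' = C at *
  -- The Jacobian of the forms `N₀, N₁, N₂` below is the required cubic up to a constant factor; `σ`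
  -- adjusts it.
  obtain ⟨σ, hσ⟩ : ∃ σ, σ * (A 0 * B 1 * C 2 * G.det) = -k :=
    ⟨-k / (A 0 * B 1 * C 2 * G.det), by field_simp⟩
  -- The three degenerate members of the net with singular points `C`, `B`, `A`; the remaining
  -- entries are chosen so that the other two pairs are conjugate.
  let N₀ : Matrix (Fin 3) (Fin 3) ℝ :=
    !![-(A 1 * B 1), A 0 * B 1, 0; A 0 * B 1, -(A 0 * B 0), 0; 0, 0, 0]
  let N₁ : Matrix (Fin 3) (Fin 3) ℝ :=
    !![-(A 2 * C 2), 0, A 0 * C 2; 0, 0, 0; A 0 * C 2, 0, -(A 0 * C 0)]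
  let N₂ : Matrix (Fin 3) (Fin 3) ℝ :=
    !![0, 0, 0; 0, -(B 2 * C 2), B 1 * C 2; 0, B 1 * C 2, -(B 1 * C 1)]
  have hmv : ∀ N : Matrix (Fin 3) (Fin 3) ℝ, ∀ x, (Gᵀ * N * G) *ᵥ x = (N *ᵥ (G *ᵥ x)) ᵥ* G := by
    intro N x
    rw [← Matrix.mulVec_mulVec, ← Matrix.mulVec_mulVec, Matrix.mulVec_transpose]
  have hdot : ∀ N : Matrix (Fin 3) (Fin 3) ℝ, ∀ x y,
      x ⬝ᵥ (Gᵀ * N * G) *ᵥ y = (G *ᵥ x) ⬝ᵥ N *ᵥ (G *ᵥ y) := by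
    intro N x y
    rw [hmv, dotProduct_comm, ← Matrix.dotProduct_mulVec, dotProduct_comm]
  have hsymm : ∀ N : Matrix (Fin 3) (Fin 3) ℝ, N.IsSymm → (Gᵀ * N * G).IsSymm := by
    intro N hN
    rw [Matrix.IsSymm, Matrix.transpose_mul, Matrix.transpose_mul, hN.eq, Matrix.transpose_transpose,
      Matrix.mul_assoc]
  have hconj : ∀ x y, (G *ᵥ x) ⬝ᵥ N₀ *ᵥ (G *ᵥ y) = 0 → (G *ᵥ x) ⬝ᵥ N₁ *ᵥ (G *ᵥ y) = 0 →
      (G *ᵥ x) ⬝ᵥ N₂ *ᵥ (G *ᵥ y) = 0 →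
      Conj ![Gᵀ * (σ • N₀) * G, Gᵀ * N₁ * G, Gᵀ * N₂ * G] x y := by
    intro x y h0 h1 h2 i
    fin_cases i
    · simp only [Fin.zero_eta, Matrix.cons_val]
      rw [hdot, Matrix.smul_mulVec, dotProduct_smul, h0, smul_zero]
    · simpa [hdot] using h1
    · simpa [hdot] using h2
  refine ⟨![Gᵀ * (σ • N₀) * G, Gᵀ * N₁ * G, Gᵀ * N₂ * G], ⟨?_, ?_⟩, ?_, ?_, ?_⟩
  · intro i
    fin_cases i
    · refine hsymm _ ?_
      ext i j; fin_cases i <;> fin_cases j <;> simp [N₀]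
    · refine hsymm _ ?_
      ext i j; fin_cases i <;> fin_cases j <;> simp [N₁]
    · refine hsymm _ ?_
      ext i j; fin_cases i <;> fin_cases j <;> simp [N₂]
  · intro x
    simp only [Matrix.cons_val]
    rw [hmv, hmv, hmv]
    conv_lhs => rw [hco x, hk]
    generalize G *ᵥ x = y
    rw [det_vecMul]
    have h0 : (σ • N₀) *ᵥ y = σ • ![B 1 * (A 0 * y 1 - A 1 * y 0), A 0 * (B 1 * y 0 - B 0 * y 1), 0] := by
      rw [Matrix.smul_mulVec]
      congr 1
      ext i; fin_cases i <;> simp [N₀, Matrix.mulVec, dotProduct, Fin.sum_univ_three] <;> ring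
    have h1 : N₁ *ᵥ y = ![C 2 * (A 0 * y 2 - A 2 * y 0), 0, A 0 * (C 2 * y 0 - C 0 * y 2)] := by
      ext i; fin_cases i <;> simp [N₁, Matrix.mulVec, dotProduct, Fin.sum_univ_three] <;> ring
    have h2 : N₂ *ᵥ y = ![0, C 2 * (B 1 * y 2 - B 2 * y 1), B 1 * (C 2 * y 1 - C 1 * y 2)] := by
      ext i; fin_cases i <;> simp [N₂, Matrix.mulVec, dotProduct, Fin.sum_univ_three] <;> ring
    rw [h0, h1, h2, det_eq_dotProduct_cross]
    simp [cross_apply, dotProduct, Fin.sum_univ_three]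
    linear_combination ((A 0 * y 1 - A 1 * y 0) * (B 1 * y 2 - B 2 * y 1) * (C 2 * y 0 - C 0 * y 2)
        + (A 0 * y 2 - A 2 * y 0) * (B 1 * y 0 - B 0 * y 1) * (C 2 * y 1 - C 1 * y 2)) * hσ
  · refine hconj _ _ ?_ ?_ ?_ <;> rw [hGa, hA] <;>
      simp [N₀, N₁, N₂, Matrix.mulVec, dotProduct, Fin.sum_univ_three] <;> ring
  · refine hconj _ _ ?_ ?_ ?_ <;> rw [hGb, hB] <;>
      simp [N₀, N₁, N₂, Matrix.mulVec, dotProduct, Fin.sum_univ_three] <;> ring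
  · refine hconj _ _ ?_ ?_ ?_ <;> rw [hGc, hC] <;>
      simp [N₀, N₁, N₂, Matrix.mulVec, dotProduct, Fin.sum_univ_three] <;> ring

theorem dotProduct_mulVec_comm {W : Matrix (Fin 3) (Fin 3) ℝ} (hW : W.IsSymm) (x y : Fin 3 → ℝ) :
    x ⬝ᵥ W *ᵥ y = y ⬝ᵥ W *ᵥ x := by
  rw [Matrix.dotProduct_mulVec, ← Matrix.mulVec_transpose, hW.eq, dotProduct_comm]

theorem Conj.symm {Γ : MvPolynomial (Fin 3) ℝ} {N : Fin 3 → Matrix (Fin 3) (Fin 3) ℝ}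
    (hJ : IsJacobian Γ N) {x y : Fin 3 → ℝ} (h : Conj N x y) : Conj N y x := fun i => by
  rw [dotProduct_mulVec_comm (hJ.isSymm i)]
  exact h i

/-- The element of the net with coordinates `w`. -/
def netForm (N : Fin 3 → Matrix (Fin 3) (Fin 3) ℝ) (w : Fin 3 → ℝ) : Matrix (Fin 3) (Fin 3) ℝ :=
  w 0 • N 0 + w 1 • N 1 + w 2 • N 2

theorem netForm_mulVec (N : Fin 3 → Matrix (Fin 3) (Fin 3) ℝ) (w x : Fin 3 → ℝ) :
    netForm N w *ᵥ x = w 0 • (N 0 *ᵥ x) + w 1 • (N 1 *ᵥ x) + w 2 • (N 2 *ᵥ x) := by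
  simp only [netForm, Matrix.add_mulVec, Matrix.smul_mulVec]

theorem netForm_isSymm {Γ : MvPolynomial (Fin 3) ℝ} {N : Fin 3 → Matrix (Fin 3) (Fin 3) ℝ}
    (hJ : IsJacobian Γ N) (w : Fin 3 → ℝ) : (netForm N w).IsSymm := by
  simp only [netForm, Matrix.IsSymm, Matrix.transpose_add, Matrix.transpose_smul,
    (hJ.isSymm _).eq]

theorem Conj.netForm_eq_zero {N : Fin 3 → Matrix (Fin 3) (Fin 3) ℝ} {x y : Fin 3 → ℝ}
    (h : Conj N x y) (w : Fin 3 → ℝ) : x ⬝ᵥ netForm N w *ᵥ y = 0 := by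
  rw [netForm_mulVec]
  simp only [dotProduct_add, dotProduct_smul, h 0, h 1, h 2, smul_zero, add_zero]

theorem triple_smul_eq (u v w y : Fin 3 → ℝ) : (u ⬝ᵥ (v ⨯₃ w)) • y =
    (u ⬝ᵥ y) • (v ⨯₃ w) + (v ⬝ᵥ y) • (w ⨯₃ u) + (w ⬝ᵥ y) • (u ⨯₃ v) := by
  ext i
  fin_cases i <;> simp [cross_apply, dotProduct, Fin.sum_univ_three] <;> ring

theorem triple_smul_eq' (u v w y : Fin 3 → ℝ) : (u ⬝ᵥ (v ⨯₃ w)) • y =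
    ((v ⨯₃ w) ⬝ᵥ y) • u + ((w ⨯₃ u) ⬝ᵥ y) • v + ((u ⨯₃ v) ⬝ᵥ y) • w := by
  ext i
  fin_cases i <;> simp [cross_apply, dotProduct, Fin.sum_univ_three] <;> ring

/-! ### Points of the Jacobian curve, their gradients and their partners -/

section Jacobian

variable {Γ : MvPolynomial (Fin 3) ℝ} {N : Fin 3 → Matrix (Fin 3) (Fin 3) ℝ}

/-- The three vectors `Nᵢx` are all orthogonal to the nonzero vector `y`, hence dependent. -/
theorem IsJacobian.det_eq_zero (hJ : IsJacobian Γ N) {x y : Fin 3 → ℝ}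
    (h : Conj N x y) (hy : y ≠ 0) : (N 0 *ᵥ x) ⬝ᵥ ((N 1 *ᵥ x) ⨯₃ (N 2 *ᵥ x)) = 0 := by
  have h' : ∀ i, (N i *ᵥ x) ⬝ᵥ y = 0 := fun i => by
    rw [dotProduct_comm]
    exact (h.symm hJ) i
  have key := triple_smul_eq (N 0 *ᵥ x) (N 1 *ᵥ x) (N 2 *ᵥ x) y
  rw [h', h', h', zero_smul, zero_smul, zero_smul, add_zero, add_zero] at key
  exact (smul_eq_zero.mp key).resolve_right hy

theorem IsJacobian.eval_eq_zero (hJ : IsJacobian Γ N) {x y : Fin 3 → ℝ}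
    (h : Conj N x y) (hy : y ≠ 0) : eval x Γ = 0 := by
  rw [hJ.eval_eq, det_eq_dotProduct_cross, hJ.det_eq_zero h hy]

theorem IsJacobian.grad_dotProduct (hJ : IsJacobian Γ N) (h : Γ.IsHomogeneous 3)
    (p v : Fin 3 → ℝ) : grad Γ p ⬝ᵥ v = (N 0 *ᵥ v) ⬝ᵥ ((N 1 *ᵥ p) ⨯₃ (N 2 *ᵥ p))
      + (N 1 *ᵥ v) ⬝ᵥ ((N 2 *ᵥ p) ⨯₃ (N 0 *ᵥ p)) + (N 2 *ᵥ v) ⬝ᵥ ((N 0 *ᵥ p) ⨯₃ (N 1 *ᵥ p)) := by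
  -- Half the difference of the values at `p + v` and `p - v` is the derivative at `p` along `v`
  -- plus `Γ(v)`; this yields the product rule for the determinant.
  have e1 := eval_smul_add_smul h 1 1 p v
  have e2 := eval_smul_add_smul h 1 (-1) p v
  simp only [hJ.eval_eq, det_eq_dotProduct_cross, Matrix.mulVec_add, Matrix.mulVec_smul] at e1 e2
  generalize N 0 *ᵥ p = r0 at *
  generalize N 1 *ᵥ p = r1 at *
  generalize N 2 *ᵥ p = r2 at *
  generalize N 0 *ᵥ v = v0 at *
  generalize N 1 *ᵥ v = v1 at *
  generalize N 2 *ᵥ v = v2 at *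
  generalize grad Γ p ⬝ᵥ v = g at *
  generalize grad Γ v ⬝ᵥ p = g' at *
  simp [cross_apply, dotProduct, Fin.sum_univ_three] at e1 e2 ⊢
  linear_combination (e2 - e1) / 2

/-- If `p` and `p'` are conjugate with respect to the net, then some polarity of the net has `p` as
a singular point, and it maps `p'` to the tangent at `p`. -/
theorem IsJacobian.exists_netForm (hJ : IsJacobian Γ N) (h : Γ.IsHomogeneous 3)
    {p p' : Fin 3 → ℝ} (hp' : p' ≠ 0) (hc : Conj N p p') :
    ∃ w, netForm N w *ᵥ p = 0 ∧ netForm N w *ᵥ p' = grad Γ p := by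
  have hr : ∀ i, (N i *ᵥ p) ⬝ᵥ p' = 0 := fun i => by
    rw [dotProduct_comm]
    exact (hc.symm hJ) i
  have hk : ∀ i j, ∃ k : ℝ, (N i *ᵥ p) ⨯₃ (N j *ᵥ p) = k • p' := by
    intro i j
    refine exists_eq_smul_of_cross_eq_zero hp' ?_
    rw [cross_cross_eq_smul_sub_smul, hr, hr, zero_smul, zero_smul, sub_zero]
  obtain ⟨k0, hk0⟩ := hk 1 2
  obtain ⟨k1, hk1⟩ := hk 2 0
  obtain ⟨k2, hk2⟩ := hk 0 1
  -- The products `Nᵢp ⨯₃ Nⱼp` are the multiples `k` of `p'`. Used as weights, these `k` form the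
  -- linear dependence between the vectors `Nᵢp`, and the product rule turns the same combination at
  -- `p'` into the gradient.
  refine ⟨![k0, k1, k2], ?_, ?_⟩
  · have key := triple_smul_eq' (N 0 *ᵥ p) (N 1 *ᵥ p) (N 2 *ᵥ p) p'
    rw [hJ.det_eq_zero hc hp', hk0, hk1, hk2, zero_smul] at key
    simp only [smul_dotProduct, smul_eq_mul, mul_comm _ (p' ⬝ᵥ p'), mul_smul,
      ← smul_add] at key
    rw [netForm_mulVec]
    exact (smul_eq_zero.mp key.symm).resolve_left (dotProduct_self_ne_zero hp')
  · refine dotProduct_eq _ _ fun v => ?_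
    rw [hJ.grad_dotProduct h, hk0, hk1, hk2, netForm_mulVec]
    have hs : ∀ i, (N i *ᵥ v) ⬝ᵥ p' = (N i *ᵥ p') ⬝ᵥ v := fun i => by
      rw [dotProduct_comm, dotProduct_mulVec_comm (hJ.isSymm i), dotProduct_comm]
    simp [add_dotProduct, hs]

/-- The partner of a nonsingular point is unique. -/
theorem IsJacobian.cross_eq_zero (hJ : IsJacobian Γ N) (h : Γ.IsHomogeneous 3)
    {p y z : Fin 3 → ℝ} (hp : grad Γ p ≠ 0) (hy : Conj N p y) (hz : Conj N p z) : y ⨯₃ z = 0 := by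
  by_contra hne
  -- Two independent partners would make all `Nᵢp` parallel, and every term of the gradient contains
  -- a product of two of them.
  have hk : ∀ i, ∃ k : ℝ, N i *ᵥ p = k • (y ⨯₃ z) := fun i =>
    exists_eq_smul_cross hne ((hy.symm hJ) i) ((hz.symm hJ) i)
  have hzero : ∀ i j, (N i *ᵥ p) ⨯₃ (N j *ᵥ p) = 0 := by
    intro i j
    obtain ⟨k, hk1⟩ := hk i
    obtain ⟨l, hl⟩ := hk j
    rw [hk1, hl]
    simp
  refine hp (dotProduct_eq_zero _ fun v => ?_)
  rw [hJ.grad_dotProduct h, hzero, hzero, hzero]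
  simp

end Jacobian

/-- Hesse's theorem: if two pairs of opposite vertices of a complete quadrilateral are conjugate
with respect to a polarity, then so is the third. -/
theorem hesse {W : Matrix (Fin 3) (Fin 3) ℝ} (hW : W.IsSymm) {p p' q q' : Fin 3 → ℝ}
    (hp : p ⬝ᵥ W *ᵥ p' = 0) (hq : q ⬝ᵥ W *ᵥ q' = 0) :
    ((p ⨯₃ q) ⨯₃ (p' ⨯₃ q')) ⬝ᵥ W *ᵥ ((p ⨯₃ q') ⨯₃ (p' ⨯₃ q)) = 0 := by
  have h1 : (p ⨯₃ q) ⨯₃ (p' ⨯₃ q') =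
      (p ⬝ᵥ (p' ⨯₃ q')) • q - (q ⬝ᵥ (p' ⨯₃ q')) • p := by
    ext i
    fin_cases i <;> simp [cross_apply, dotProduct, Fin.sum_univ_three] <;> ring
  have h2 : (p ⨯₃ q) ⨯₃ (p' ⨯₃ q') =
      (p ⬝ᵥ (q ⨯₃ q')) • p' + (p ⬝ᵥ (p' ⨯₃ q)) • q' := by
    ext i
    fin_cases i <;> simp [cross_apply, dotProduct, Fin.sum_univ_three] <;> ring
  have h3 : (p ⨯₃ q') ⨯₃ (p' ⨯₃ q) =
      (p ⬝ᵥ (p' ⨯₃ q)) • q' + (q ⬝ᵥ (p' ⨯₃ q')) • p := by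
    ext i
    fin_cases i <;> simp [cross_apply, dotProduct, Fin.sum_univ_three] <;> ring
  -- Pairing `p` with the same vertex, written once on `pq` and once on `p'q'`, gives the only
  -- relation needed beyond `hp` and `hq`.
  have e : p ⬝ᵥ W *ᵥ ((p ⬝ᵥ (p' ⨯₃ q')) • q - (q ⬝ᵥ (p' ⨯₃ q')) • p) =
      p ⬝ᵥ W *ᵥ ((p ⬝ᵥ (q ⨯₃ q')) • p' + (p ⬝ᵥ (p' ⨯₃ q)) • q') := by rw [← h1, h2]
  rw [h1, h3]
  generalize p ⬝ᵥ (p' ⨯₃ q') = α at *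
  generalize q ⬝ᵥ (p' ⨯₃ q') = β at *
  generalize p ⬝ᵥ (p' ⨯₃ q) = γ at *
  simp only [Matrix.mulVec_add, Matrix.mulVec_sub, Matrix.mulVec_smul, dotProduct_add,
    dotProduct_sub, sub_dotProduct, dotProduct_smul, smul_dotProduct, smul_eq_mul, hp, hq] at e ⊢
  rw [dotProduct_mulVec_comm hW q p]
  linear_combination β * e

/-- Hesse's theorem for the points constructed from two pairs. -/
theorem hesse_meet {W : Matrix (Fin 3) (Fin 3) ℝ} (hW : W.IsSymm) {P P' Q Q' : ProjPoint}
    (hP : P.rep ⬝ᵥ W *ᵥ P'.rep = 0) (hQ : Q.rep ⬝ᵥ W *ᵥ Q'.rep = 0)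
    (h1 : P ≠ Q) (h2 : P' ≠ Q') (h3 : P ≠ Q') (h4 : P' ≠ Q)
    (h5 : join P Q ≠ join P' Q') (h6 : join P Q' ≠ join P' Q) :
    (meet (join P Q) (join P' Q')).rep ⬝ᵥ W *ᵥ (meet (join P Q') (join P' Q)).rep = 0 := by
  obtain ⟨c1, -, e1⟩ := rep_mk_join h1
  obtain ⟨c2, -, e2⟩ := rep_mk_join h2
  obtain ⟨c3, -, e3⟩ := rep_mk_join h3
  obtain ⟨c4, -, e4⟩ := rep_mk_join h4
  obtain ⟨c5, -, e5⟩ := rep_meet h5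
  obtain ⟨c6, -, e6⟩ := rep_meet h6
  rw [e5, e6, e1, e2, e3, e4]
  simp only [map_smul, LinearMap.smul_apply, Matrix.mulVec_smul, smul_dotProduct, dotProduct_smul,
    hesse hW hP hQ, smul_zero]

/-! ### Conjugate pairs on the Jacobian curve and their tangents -/

/-- Two distinct nonsingular points of `Γ` that are conjugate with respect to the net `N`. -/
structure IsConjPair (Γ : MvPolynomial (Fin 3) ℝ) (N : Fin 3 → Matrix (Fin 3) (Fin 3) ℝ)
    (P P' : ProjPoint) : Prop where
  ne : P ≠ P'
  conj : Conj N P.rep P'.rep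
  gradAt_ne_zero : gradAt Γ P ≠ 0
  gradAt_ne_zero' : gradAt Γ P' ≠ 0

/-- A linear form that vanishes at the point `q` of the line `τ` is on that line a multiple of
`det(τ, q, ·)`. -/
theorem exists_dotProduct_eq_mul_det {τ q v : Fin 3 → ℝ} (hτ : τ ≠ 0) (hq : q ≠ 0)
    (hτq : τ ⬝ᵥ q = 0) (hvq : v ⬝ᵥ q = 0) :
    ∃ c : ℝ, ∀ x, τ ⬝ᵥ x = 0 → v ⬝ᵥ x = c * Matrix.det ![τ, q, x] := by
  have hcross : q ⨯₃ (τ ⨯₃ q) = (q ⬝ᵥ q) • τ := by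
    have : q ⨯₃ (τ ⨯₃ q) = (q ⬝ᵥ q) • τ - (τ ⬝ᵥ q) • q := by
      ext i
      fin_cases i <;> simp [cross_apply, dotProduct, Fin.sum_univ_three] <;> ring
    rw [this, hτq, zero_smul, sub_zero]
  have hne : q ⨯₃ (τ ⨯₃ q) ≠ 0 := by
    rw [hcross]
    exact smul_ne_zero (dotProduct_self_ne_zero hq) hτ
  have hn : τ ⨯₃ q ≠ 0 := fun h0 => hne (by rw [h0, map_zero])
  refine ⟨(v ⬝ᵥ (τ ⨯₃ q)) / ((τ ⨯₃ q) ⬝ᵥ (τ ⨯₃ q)), fun x hx => ?_⟩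
  obtain ⟨s, t, rfl⟩ := exists_eq_smul_add_smul (x := x) hne (by
    rw [hcross, dotProduct_smul, dotProduct_comm x, hx, smul_zero])
  have hnn := dotProduct_self_ne_zero hn
  have hdet : Matrix.det ![τ, q, s • q + t • (τ ⨯₃ q)] = t * ((τ ⨯₃ q) ⬝ᵥ (τ ⨯₃ q)) := by
    rw [det_eq_dotProduct_cross]
    simp only [cross_apply, dotProduct, Fin.sum_univ_three, Pi.add_apply, Pi.smul_apply,
      Matrix.cons_val, smul_eq_mul]
    ring
  rw [hdet, dotProduct_add, dotProduct_smul, dotProduct_smul, hvq]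
  field_simp
  simp [mul_comm]

/-! ### Tangents at the two points of a conjugate pair -/

section Jacobian

variable {Γ : MvPolynomial (Fin 3) ℝ} {N : Fin 3 → Matrix (Fin 3) (Fin 3) ℝ}

theorem IsConjPair.symm (hJ : IsJacobian Γ N) {P P' : ProjPoint} (h : IsConjPair Γ N P P') :
    IsConjPair Γ N P' P :=
  ⟨h.ne.symm, h.conj.symm hJ, h.gradAt_ne_zero', h.gradAt_ne_zero⟩

theorem IsConjPair.onCurve (hJ : IsJacobian Γ N) {P P' : ProjPoint} (h : IsConjPair Γ N P P') :
    OnCurve Γ P := hJ.eval_eq_zero h.conj P'.rep_nonzero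

theorem IsConjPair.onCurve' (hJ : IsJacobian Γ N) {P P' : ProjPoint} (h : IsConjPair Γ N P P') :
    OnCurve Γ P' := (h.symm hJ).onCurve hJ

theorem IsConjPair.unique (hJ : IsJacobian Γ N) (hΓ : Γ.IsHomogeneous 3) {P X Y : ProjPoint}
    (hX : IsConjPair Γ N P X) (hY : IsConjPair Γ N P Y) : X = Y :=
  eq_iff_cross_rep.mpr (hJ.cross_eq_zero hΓ hX.gradAt_ne_zero hX.conj hY.conj)

/-- The gradient is `W p'` with `W` symmetric and `W p = 0`. This puts `P` on its tangent. -/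
theorem IsConjPair.gradAt_dotProduct_rep (hJ : IsJacobian Γ N) (hΓ : Γ.IsHomogeneous 3)
    {P P' : ProjPoint} (h : IsConjPair Γ N P P') : gradAt Γ P ⬝ᵥ P.rep = 0 := by
  obtain ⟨w, h0, h1⟩ := hJ.exists_netForm hΓ P'.rep_nonzero h.conj
  change grad Γ P.rep ⬝ᵥ P.rep = 0
  rw [← h1, dotProduct_comm, dotProduct_mulVec_comm (netForm_isSymm hJ w), h0, dotProduct_zero]

/-- A common tangent would touch the cubic at both `P` and `P'`, so the cubic would contain it. -/
theorem IsConjPair.tangent_ne (hJ : IsJacobian Γ N) (hΓ : Γ.IsHomogeneous 3)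
    (hirr : Irreducible Γ) {P P' : ProjPoint} (h : IsConjPair Γ N P P') {t t' : ProjLine}
    (ht : IsTangentAt Γ P t) (ht' : IsTangentAt Γ P' t') : t ≠ t' := by
  rintro rfl
  obtain ⟨hP, hg, e⟩ := ht
  obtain ⟨hP', hg', e'⟩ := ht'
  refine false_of_gradAt_dotProduct_eq_zero hΓ hirr h.ne hP hP' ?_ ?_
  · rw [dotProduct_comm, ← onLine_mk hg, ← e, e', onLine_mk, dotProduct_comm]
    exact (h.symm hJ).gradAt_dotProduct_rep hJ hΓ
  · rw [dotProduct_comm, ← onLine_mk hg', ← e', e, onLine_mk, dotProduct_comm]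
    exact h.gradAt_dotProduct_rep hJ hΓ

/-- The tangent at `P` meets the cubic in `P`, `P` and its intersection with the tangent at the
conjugate point. -/
theorem IsConjPair.lineMeetsCubicIn (hJ : IsJacobian Γ N) (hΓ : Γ.IsHomogeneous 3)
    (hirr : Irreducible Γ) {P P' R : ProjPoint} (h : IsConjPair Γ N P P') {t t' : ProjLine}
    (ht : IsTangentAt Γ P t) (ht' : IsTangentAt Γ P' t') (hR : OnLine R t) (hR' : OnLine R t') :
    LineMeetsCubicIn Γ t P P R := by
  obtain ⟨hP, hg, e⟩ := ht
  obtain ⟨hP', hg', e'⟩ := ht'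
  obtain ⟨w, h0, h1⟩ := hJ.exists_netForm hΓ P'.rep_nonzero h.conj
  obtain ⟨w', h0', h1'⟩ := hJ.exists_netForm hΓ P.rep_nonzero (h.conj.symm hJ)
  change _ = gradAt Γ P at h1
  change _ = gradAt Γ P' at h1'
  have hPt : OnLine P t := by
    rw [e, onLine_mk, dotProduct_comm]
    exact h.gradAt_dotProduct_rep hJ hΓ
  refine ⟨hPt, hPt, hR, ?_⟩
  obtain ⟨c, hc, hct⟩ := exists_rep_eq_smul hg e
  have hWs := netForm_isSymm hJ w
  have hWs' := netForm_isSymm hJ w'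
  set W := netForm N w with hW
  set W' := netForm N w' with hW'
  -- A third member of the net completing `W, W'` to a basis: the change of basis has determinant
  -- `det(w, w', u) = u ⬝ᵥ u`.
  set u := w ⨯₃ w' with hu
  have hw' : w' ≠ 0 := by
    intro h00
    refine hg' ?_
    rw [← h1', hW', netForm_mulVec, h00]
    simp
  have hu0 : u ≠ 0 := by
    intro h00
    obtain ⟨k, hk⟩ := exists_eq_smul_of_cross_eq_zero hw' (hu.symm.trans h00)
    refine hg ?_
    have : netForm N w *ᵥ P'.rep = k • netForm N w' *ᵥ P'.rep := by
      rw [hk, netForm_mulVec, netForm_mulVec]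
      simp [mul_smul]
    rw [← h1, hW, this, ← hW', h0', smul_zero]
  set U := netForm N u with hU
  have hn := cross_rep_ne_zero h.ne
  set n := P.rep ⨯₃ P'.rep with hn'
  -- For `x` on the tangent, `W x` is orthogonal to `P` and `P'`, hence a multiple of `n`. Since
  -- also `W' P' = 0`, the determinant of `W x`, `W' x`, `U x` becomes a product of linear forms.
  -- The forms `W n` and `U P'` vanish at `P`; `W' P` is the gradient at `P'`.
  have hmain : ∀ x, t.rep ⬝ᵥ x = 0 → ((n ⬝ᵥ n) * (u ⬝ᵥ u)) * eval x Γ =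
      ((W *ᵥ n) ⬝ᵥ x) * ((U *ᵥ P'.rep) ⬝ᵥ x) * ((W' *ᵥ P.rep) ⬝ᵥ x) := by
    intro x hx
    have hx' : P'.rep ⬝ᵥ W *ᵥ x = 0 := by
      rw [dotProduct_mulVec_comm hWs, h1, dotProduct_comm]
      rw [hct, smul_dotProduct, smul_eq_mul] at hx
      exact (mul_eq_zero.mp hx).resolve_left hc
    have hx0 : P.rep ⬝ᵥ W *ᵥ x = 0 := by
      rw [dotProduct_mulVec_comm hWs, h0, dotProduct_zero]
    obtain ⟨f, hf⟩ := exists_eq_smul_cross hn hx0 hx'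
    have hdet : (u ⬝ᵥ u) * eval x Γ = Matrix.det ![W *ᵥ x, W' *ᵥ x, U *ᵥ x] := by
      have hv : ∀ z, netForm N z *ᵥ x = z ᵥ* Matrix.of ![N 0 *ᵥ x, N 1 *ᵥ x, N 2 *ᵥ x] := by
        intro z
        rw [netForm_mulVec]
        ext i
        simp [Matrix.vecMul, dotProduct, Fin.sum_univ_three]
      rw [hW, hW', hU, hv, hv, hv, det_vecMul, hJ.eval_eq, det_eq_dotProduct_cross w w' u,
        triple_product_permutation, triple_product_permutation]
      rfl
    have e1 : (W *ᵥ n) ⬝ᵥ x = f * (n ⬝ᵥ n) := by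
      rw [dotProduct_comm, dotProduct_mulVec_comm hWs, hf, dotProduct_smul, smul_eq_mul]
    have e2 : n ⬝ᵥ ((W' *ᵥ x) ⨯₃ (U *ᵥ x)) = ((U *ᵥ P'.rep) ⬝ᵥ x) * ((W' *ᵥ P.rep) ⬝ᵥ x) := by
      rw [hn', cross_dot_cross, dotProduct_mulVec_comm hWs' P'.rep, h0', dotProduct_zero,
        dotProduct_mulVec_comm hWs' P.rep, dotProduct_mulVec_comm (netForm_isSymm hJ u) P'.rep,
        dotProduct_comm x, dotProduct_comm x]
      ring
    rw [e1, mul_assoc (n ⬝ᵥ n), hdet, det_eq_dotProduct_cross, hf, smul_dotProduct, e2,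
      smul_eq_mul]
    ring
  have hτP : t.rep ⬝ᵥ P.rep = 0 := by rw [dotProduct_comm, ← onLine_iff]; exact hPt
  have hτR : t.rep ⬝ᵥ R.rep = 0 := by rw [dotProduct_comm, ← onLine_iff]; exact hR
  obtain ⟨c1, hc1⟩ := exists_dotProduct_eq_mul_det (v := W *ᵥ n) t.rep_nonzero P.rep_nonzero hτP
    (by rw [dotProduct_comm, dotProduct_mulVec_comm hWs, h0, dotProduct_zero])
  obtain ⟨c2, hc2⟩ := exists_dotProduct_eq_mul_det (v := U *ᵥ P'.rep) t.rep_nonzero P.rep_nonzero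
    hτP (by rw [dotProduct_comm, h.conj.netForm_eq_zero u])
  obtain ⟨c3, hc3⟩ := exists_dotProduct_eq_mul_det (v := W' *ᵥ P.rep) t.rep_nonzero R.rep_nonzero
    hτR (by rw [dotProduct_comm, h1', ← onLine_mk hg', ← e']; exact hR')
  have hk : (n ⬝ᵥ n) * (u ⬝ᵥ u) ≠ 0 :=
    mul_ne_zero (dotProduct_self_ne_zero hn) (dotProduct_self_ne_zero hu0)
  have hfin : ∀ x, t.rep ⬝ᵥ x = 0 → eval x Γ = c1 * c2 * c3 / ((n ⬝ᵥ n) * (u ⬝ᵥ u)) *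
      (Matrix.det ![t.rep, P.rep, x] * Matrix.det ![t.rep, P.rep, x] *
        Matrix.det ![t.rep, R.rep, x]) := by
    intro x hx
    have := hmain x hx
    rw [hc1 x hx, hc2 x hx, hc3 x hx] at this
    rw [div_mul_eq_mul_div, eq_div_iff hk]
    linear_combination this
  refine ⟨_, ?_, hfin⟩
  intro hzero
  obtain ⟨x, hx, hne⟩ := exists_eval_ne_zero_of_irreducible hΓ hirr t.rep_nonzero
  refine hne ?_
  rw [hfin x hx, hzero, zero_mul]

/-- For a point `P` of a conjugate pair, the net contains a polarity with singular point `P`. It maps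
the points of a line through `P` to the line that is conjugate to it. -/
theorem IsConjPair.exists_form (hJ : IsJacobian Γ N) (hΓ : Γ.IsHomogeneous 3)
    {P P' : ProjPoint} (h : IsConjPair Γ N P P') :
    ∃ W : Matrix (Fin 3) (Fin 3) ℝ, W.IsSymm ∧ W *ᵥ P.rep = 0 ∧ W *ᵥ P'.rep = gradAt Γ P ∧
      ∀ x y, Conj N x y → x ⬝ᵥ W *ᵥ y = 0 := by
  obtain ⟨w, h0, h1⟩ := hJ.exists_netForm hΓ P'.rep_nonzero h.conj
  exact ⟨netForm N w, netForm_isSymm hJ w, h0, h1, fun x y hxy => hxy.netForm_eq_zero w⟩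

end Jacobian

/-! ### Line involutions -/

theorem det_ne_zero_of_ne {S : ProjPoint} {a b : ProjLine} (ha : OnLine S a) (hb : OnLine S b)
    (hab : a ≠ b) : Matrix.det ![S.rep, a.rep, b.rep] ≠ 0 := by
  rw [det_eq_dotProduct_cross]
  intro h0
  rw [onLine_iff, dotProduct_comm] at ha hb
  obtain ⟨c, hc⟩ := exists_eq_smul_cross (cross_rep_ne_zero hab) ha hb
  rw [hc, smul_dotProduct, smul_eq_mul, mul_eq_zero] at h0
  rcases h0 with rfl | h0
  · exact S.rep_nonzero (by simpa using hc)
  · exact dotProduct_self_ne_zero (cross_rep_ne_zero hab) h0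

/-- A line of a pencil is determined by its cross-ratio with three lines of the pencil. -/
theorem eq_of_crossRatio_eq {S : ProjPoint} {a b x y z : ProjLine} (ha : OnLine S a)
    (hb : OnLine S b) (hx : OnLine S x) (hy : OnLine S y) (hz : OnLine S z) (hab : a ≠ b)
    (hax : a ≠ x) (hbx : b ≠ x) (hay : a ≠ y) (haz : a ≠ z)
    (h : crossRatio S a b x y = crossRatio S a b x z) : y = z := by
  by_contra hyz
  have h1 := det_ne_zero_of_ne ha hb hab
  have h2 := det_ne_zero_of_ne ha hx hax
  have h3 := det_ne_zero_of_ne hb hx hbx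
  have h4 := det_ne_zero_of_ne ha hy hay
  have h5 := det_ne_zero_of_ne ha hz haz
  refine mul_ne_zero h1 (det_ne_zero_of_ne hy hz hyz) ?_
  rw [crossRatio, crossRatio, div_eq_div_iff (mul_ne_zero h4 h3) (mul_ne_zero h5 h3)] at h
  have h' : Matrix.det ![S.rep, b.rep, y.rep] * Matrix.det ![S.rep, a.rep, z.rep] =
      Matrix.det ![S.rep, b.rep, z.rep] * Matrix.det ![S.rep, a.rep, y.rep] :=
    mul_left_cancel₀ (mul_ne_zero h2 h3) (by linear_combination h)
  -- The three-term Plücker relation turns equality of the cross-ratios into `det(S, a, b) * det(S,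
  -- y, z) = 0`.
  have pluecker : ∀ s u v w r : Fin 3 → ℝ, Matrix.det ![s, u, v] * Matrix.det ![s, w, r] =
      Matrix.det ![s, u, w] * Matrix.det ![s, v, r]
        - Matrix.det ![s, u, r] * Matrix.det ![s, v, w] := by
    intro s u v w r
    simp only [det_eq_dotProduct_cross, cross_apply, dotProduct, Fin.sum_univ_three,
      Matrix.cons_val]
    ring
  rw [pluecker]
  linear_combination -h'

/-- A line involution is determined by two pairs of conjugate lines. -/
theorem IsLineInvolution.eq_of_eq {S : ProjPoint} {Λ Λ' : ProjLine → ProjLine}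
    (h : IsLineInvolution S Λ) (h' : IsLineInvolution S Λ') {a b c : ProjLine}
    (ha : OnLine S a) (hb : OnLine S b) (hc : OnLine S c)
    (hnd : [a, Λ a, b, Λ b].Nodup) (hΛa : Λ' a = Λ a) (hΛb : Λ' b = Λ b) : Λ c = Λ' c := by
  simp only [List.nodup_cons, List.mem_cons, List.not_mem_nil, or_false, not_or, not_false_eq_true,
    List.nodup_nil, and_true] at hnd
  obtain ⟨⟨haa, hab, hab'⟩, ⟨hba, hba'⟩, hbb⟩ := hnd
  have e1 := h.involutive a ha
  have e2 := h.involutive b hb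
  have e1' := h'.involutive a ha
  have e2' := h'.involutive b hb
  rw [hΛa] at e1'
  rw [hΛb] at e2'
  by_cases hca : c = a
  · rw [hca, hΛa]
  by_cases hca' : c = Λ a
  · rw [hca', e1, e1']
  by_cases hcb : c = b
  · rw [hcb, hΛb]
  by_cases hcb' : c = Λ b
  · rw [hcb', e2, e2']
  -- Once `c` differs from the four given lines, the quadruple `a, Λ a, b, c` represents three
  -- different pairs. Its cross-ratio then fixes the image of `c`.
  have key : ∀ Ψ : ProjLine → ProjLine, IsLineInvolution S Ψ → Ψ a = Λ a → Ψ b = Λ b →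
      crossRatio S a (Λ a) b c = crossRatio S (Λ a) a (Λ b) (Ψ c) ∧ Λ a ≠ Ψ c := by
    intro Ψ hΨ hΨa hΨb
    have hΨaa : Ψ (Λ a) = a := by rw [← hΨa]; exact hΨ.involutive a ha
    constructor
    · have := hΨ.crossRatio_eq a b c ha hb hc ?_ ?_ ?_ ![a, Λ a, b, c] ?_ ?_ ?_ ?_ ?_
      · simpa [hΨa, hΨb, hΨaa] using this
      · intro hs
        have : a ∈ ({b, Ψ b} : Set ProjLine) := hs ▸ Set.mem_insert _ _
        rw [hΨb] at this
        exact this.elim hab hab'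
      · intro hs
        have : c ∈ ({a, Ψ a} : Set ProjLine) := hs ▸ Set.mem_insert _ _
        rw [hΨa] at this
        exact this.elim hca hca'
      · intro hs
        have : c ∈ ({b, Ψ b} : Set ProjLine) := hs ▸ Set.mem_insert _ _
        rw [hΨb] at this
        exact this.elim hcb hcb'
      · intro i j hij
        fin_cases i <;> fin_cases j <;> simp_all
      · intro i
        fin_cases i <;> simp [hΨa]
      · exact ⟨0, by simp⟩
      · exact ⟨2, by simp⟩
      · exact ⟨3, by simp⟩
    · intro h0
      refine hca ?_
      rw [← hΨ.involutive c hc, ← h0, hΨaa]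
  obtain ⟨k1, k2⟩ := key Λ h rfl rfl
  obtain ⟨k1', k2'⟩ := key Λ' h' hΛa hΛb
  exact eq_of_crossRatio_eq (h.mapsTo a ha) ha (h.mapsTo b hb) (h.mapsTo c hc) (h'.mapsTo c hc)
    (Ne.symm haa) hba' hab' k2 k2' (k1.symm.trans k1')

/-! ### The line involution of a degenerate polarity -/

section Polar

variable {P : ProjPoint} {W : Matrix (Fin 3) (Fin 3) ℝ}

theorem cross_rep_ne_zero_of_onLine {l : ProjLine} (hl : OnLine P l) : l.rep ⨯₃ P.rep ≠ 0 := by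
  intro h0
  obtain ⟨c, hc⟩ := exists_eq_smul_of_cross_eq_zero P.rep_nonzero h0
  rw [onLine_iff, hc, dotProduct_smul, smul_eq_mul, mul_eq_zero] at hl
  rcases hl with rfl | hl
  · exact l.rep_nonzero (by simpa using hc)
  · exact dotProduct_self_ne_zero P.rep_nonzero hl

/-- The dot product is definite, so `l ⨯₃ P` is a point of `l` other than `P`. -/
theorem exists_onLine_ne {l : ProjLine} (hl : OnLine P l) : ∃ X, OnLine X l ∧ P ≠ X := by
  have hne := cross_rep_ne_zero_of_onLine hl
  refine ⟨Projectivization.mk ℝ _ hne, ?_, ?_⟩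
  · rw [OnLine, Projectivization.orthogonal_comm, ← OnLine, onLine_mk, dot_self_cross]
  · intro h0
    obtain ⟨c, -, hc⟩ := exists_rep_eq_smul hne h0
    refine dotProduct_self_ne_zero P.rep_nonzero ?_
    calc P.rep ⬝ᵥ P.rep = P.rep ⬝ᵥ (c • (l.rep ⨯₃ P.rep)) := by rw [← hc]
      _ = 0 := by rw [dotProduct_smul, dot_cross_self, smul_zero]

open Classical in
/-- The line conjugate to a line through the singular point `P` of a degenerate polarity `W`. -/
noncomputable def polarLine (P : ProjPoint) (W : Matrix (Fin 3) (Fin 3) ℝ) (l : ProjLine) :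
    ProjLine :=
  -- For a line through `P`, `l ⨯₃ P` represents a second point of it. The default `l` is never
  -- reached on the pencil when `P` is the only singular point.
  if h : W *ᵥ (l.rep ⨯₃ P.rep) ≠ 0 then Projectivization.mk ℝ _ h else l

/-- `P` is the only singular point of the polarity `W`. -/
structure IsPencilForm (P : ProjPoint) (W : Matrix (Fin 3) (Fin 3) ℝ) : Prop where
  isSymm : W.IsSymm
  mulVec_rep : W *ᵥ P.rep = 0
  eq_of_mulVec : ∀ X : ProjPoint, W *ᵥ X.rep = 0 → X = P

theorem IsPencilForm.cross_eq_zero (hW : IsPencilForm P W) {x : Fin 3 → ℝ} (hx : W *ᵥ x = 0) :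
    x ⨯₃ P.rep = 0 := by
  by_cases h0 : x = 0
  · simp [h0]
  · obtain ⟨a, ha⟩ := Projectivization.exists_smul_eq_mk_rep ℝ x h0
    have := hW.eq_of_mulVec (Projectivization.mk ℝ x h0) (by
      rw [← ha, Units.smul_def, Matrix.mulVec_smul, hx, smul_zero])
    rw [eq_iff_cross_rep, ← ha, Units.smul_def, map_smul, LinearMap.smul_apply] at this
    exact (smul_eq_zero.mp this).resolve_left a.ne_zero

theorem IsPencilForm.rep_polarLine (hW : IsPencilForm P W) {l : ProjLine} (hl : OnLine P l) :
    ∃ c : ℝ, c ≠ 0 ∧ (polarLine P W l).rep = c • (W *ᵥ (l.rep ⨯₃ P.rep)) := by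
  have h : W *ᵥ (l.rep ⨯₃ P.rep) ≠ 0 := by
    intro h0
    have h1 := hW.cross_eq_zero h0
    rw [cross_cross_eq_smul_sub_smul, dotProduct_comm l.rep, onLine_iff.mp hl, zero_smul,
      zero_sub, neg_eq_zero, smul_eq_zero] at h1
    exact h1.elim (dotProduct_self_ne_zero P.rep_nonzero) l.rep_nonzero
  exact exists_rep_eq_smul h (by rw [polarLine, dif_pos h])

theorem IsPencilForm.onLine_polarLine (hW : IsPencilForm P W) {l : ProjLine} (hl : OnLine P l) :
    OnLine P (polarLine P W l) := by
  obtain ⟨c, -, hc⟩ := hW.rep_polarLine hl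
  rw [onLine_iff, hc, dotProduct_smul, dotProduct_mulVec_comm hW.isSymm, hW.mulVec_rep,
    dotProduct_zero, smul_zero]

/-- The line conjugate to `PX` consists of the points conjugate to `X`. -/
theorem IsPencilForm.onLine_polarLine_iff (hW : IsPencilForm P W) {l : ProjLine} {X Z : ProjPoint}
    (hl : OnLine P l) (hX : OnLine X l) (hPX : P ≠ X) :
    OnLine Z (polarLine P W l) ↔ X.rep ⬝ᵥ W *ᵥ Z.rep = 0 := by
  obtain ⟨c, hc0, hc⟩ := hW.rep_polarLine hl
  obtain ⟨d, hd0, hd⟩ := rep_mk_join hPX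
  rw [← eq_join hPX hl hX] at hd
  have : W *ᵥ (l.rep ⨯₃ P.rep) = (d * (P.rep ⬝ᵥ P.rep)) • W *ᵥ X.rep := by
    rw [hd, map_smul, LinearMap.smul_apply, Matrix.mulVec_smul, cross_cross_eq_smul_sub_smul,
      Matrix.mulVec_sub, Matrix.mulVec_smul, Matrix.mulVec_smul, hW.mulVec_rep, smul_zero,
      sub_zero, smul_smul]
  rw [onLine_iff, hc, this, smul_smul, dotProduct_smul, smul_eq_mul, mul_eq_zero,
    dotProduct_mulVec_comm hW.isSymm]
  refine or_iff_right ?_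
  exact mul_ne_zero hc0 (mul_ne_zero hd0 (dotProduct_self_ne_zero P.rep_nonzero))

theorem IsPencilForm.polarLine_join (hW : IsPencilForm P W) {X Y : ProjPoint} (hX : P ≠ X)
    (hY : P ≠ Y) (h : X.rep ⬝ᵥ W *ᵥ Y.rep = 0) : polarLine P W (join P X) = join P Y :=
  eq_join hY (hW.onLine_polarLine (onLine_join_left hX))
    ((hW.onLine_polarLine_iff (onLine_join_left hX) (onLine_join_right hX) hX).mpr h)

/-- The determinant of the images of two lines of the pencil. -/
theorem IsPencilForm.exists_det_eq (hW : IsPencilForm P W) : ∃ k : ℝ, k ≠ 0 ∧ ∀ a x : Fin 3 → ℝ,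
    Matrix.det ![P.rep, W *ᵥ (a ⨯₃ P.rep), W *ᵥ (x ⨯₃ P.rep)] =
      k * Matrix.det ![P.rep, a, x] := by
  set p := P.rep with hp
  have hpp : p ⬝ᵥ p ≠ 0 := dotProduct_self_ne_zero P.rep_nonzero
  -- The rank-one term makes `W` invertible without changing it on the vectors `v ⨯₃ p`, which are
  -- orthogonal to `p`; `p` itself becomes an eigenvector.
  set V := W + Matrix.vecMulVec p p with hV
  have hVv : ∀ v, V *ᵥ v = W *ᵥ v + (p ⬝ᵥ v) • p := by
    intro v
    rw [hV, Matrix.add_mulVec, Matrix.vecMulVec_mulVec]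
    simp
  refine ⟨V.det, ?_, fun a x => ?_⟩
  · intro h0
    obtain ⟨v, hv0, hv⟩ := Matrix.exists_mulVec_eq_zero_iff.mpr h0
    rw [hVv] at hv
    have h1 := congrArg (p ⬝ᵥ ·) hv
    simp only [dotProduct_add, dotProduct_smul, dotProduct_zero] at h1
    rw [dotProduct_mulVec_comm hW.isSymm, hW.mulVec_rep, dotProduct_zero, zero_add, smul_eq_mul,
      mul_eq_zero, or_iff_left hpp] at h1
    rw [h1, zero_smul, add_zero] at hv
    obtain ⟨c, rfl⟩ := exists_eq_smul_of_cross_eq_zero P.rep_nonzero (hW.cross_eq_zero hv)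
    rw [dotProduct_smul, smul_eq_mul, mul_eq_zero, or_iff_left hpp] at h1
    exact hv0 (by rw [h1, zero_smul])
  · refine mul_left_cancel₀ hpp ?_
    have e1 : V *ᵥ p = (p ⬝ᵥ p) • p := by rw [hVv, hW.mulVec_rep, zero_add]
    have e2 : ∀ v, V *ᵥ (v ⨯₃ p) = W *ᵥ (v ⨯₃ p) := fun v => by
      rw [hVv, dot_cross_self, zero_smul, add_zero]
    have e3 : Matrix.det ![V *ᵥ p, V *ᵥ (a ⨯₃ p), V *ᵥ (x ⨯₃ p)] =
        Matrix.det ![p, a ⨯₃ p, x ⨯₃ p] * V.det := by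
      simp only [← Matrix.vecMul_transpose]
      rw [det_vecMul, Matrix.det_transpose]
    have e4 : Matrix.det ![p, a ⨯₃ p, x ⨯₃ p] = (p ⬝ᵥ p) * Matrix.det ![p, a, x] := by
      simp only [det_eq_dotProduct_cross, cross_apply, dotProduct, Fin.sum_univ_three,
        Matrix.cons_val]
      ring
    rw [e1, e2, e2, e4, det_eq_dotProduct_cross, smul_dotProduct, ← det_eq_dotProduct_cross,
      smul_eq_mul] at e3
    rw [e3]
    ring

/-- All four determinants acquire the same factor `k`, and each line's scalar occurs once above and
once below. -/
theorem IsPencilForm.crossRatio_polarLine (hW : IsPencilForm P W) {a b x y : ProjLine}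
    (ha : OnLine P a) (hb : OnLine P b) (hx : OnLine P x) (hy : OnLine P y) :
    crossRatio P (polarLine P W a) (polarLine P W b) (polarLine P W x) (polarLine P W y) =
      crossRatio P a b x y := by
  obtain ⟨ca, ha0, ha⟩ := hW.rep_polarLine ha
  obtain ⟨cb, hb0, hb⟩ := hW.rep_polarLine hb
  obtain ⟨cx, hx0, hx⟩ := hW.rep_polarLine hx
  obtain ⟨cy, hy0, hy⟩ := hW.rep_polarLine hy
  obtain ⟨k, hk0, hk⟩ := hW.exists_det_eq
  have hs : ∀ (c d : ℝ) (u v : Fin 3 → ℝ), Matrix.det ![P.rep, c • u, d • v] =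
      c * d * Matrix.det ![P.rep, u, v] := by
    intro c d u v
    simp only [det_eq_dotProduct_cross, map_smul, LinearMap.smul_apply, dotProduct_smul,
      smul_eq_mul]
    ring
  simp only [crossRatio, ha, hb, hx, hy, hs, hk]
  rw [← mul_div_mul_left (Matrix.det ![P.rep, a.rep, x.rep] * Matrix.det ![P.rep, b.rep, y.rep])
    _ (show ca * cb * cx * cy * k ^ 2 ≠ 0 by positivity)]
  congr 1 <;> ring

/-- Conjugacy with respect to a degenerate polarity is a line involution on the pencil of its
singular point. -/
theorem IsPencilForm.isLineInvolution (hW : IsPencilForm P W) :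
    IsLineInvolution P (polarLine P W) where
  mapsTo _ hl := hW.onLine_polarLine hl
  involutive l hl := by
    have hm := hW.onLine_polarLine hl
    obtain ⟨X, hX, hPX⟩ := exists_onLine_ne hl
    obtain ⟨Z, hZ, hPZ⟩ := exists_onLine_ne hm
    have hXZ := (hW.onLine_polarLine_iff hl hX hPX).mp hZ
    rw [eq_join hPX hl hX, hW.polarLine_join hPX hPZ hXZ, hW.polarLine_join hPZ hPX]
    rw [dotProduct_mulVec_comm hW.isSymm, hXZ]
  crossRatio_eq a b c ha hb hc _ _ _ l _ hl _ _ _ := by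
    have : ∀ i, OnLine P (l i) := by
      intro i
      rcases hl i with (h | h) | h <;> rcases h with h | h <;> rw [h]
      exacts [ha, hW.onLine_polarLine ha, hb, hW.onLine_polarLine hb, hc, hW.onLine_polarLine hc]
    exact (hW.crossRatio_polarLine (this 0) (this 1) (this 2) (this 3)).symm

end Polar

/-- If a degenerate polarity `W` is singular along a line, then one point of every conjugate pair
lies on that line. -/
theorem onLine_or_onLine_of_mulVec_eq_zero {P X : ProjPoint} {W : Matrix (Fin 3) (Fin 3) ℝ}
    (hW : W.IsSymm) (hP : W *ᵥ P.rep = 0) (hX : W *ᵥ X.rep = 0) (hPX : P ≠ X)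
    {v : Fin 3 → ℝ} (hv : W *ᵥ v ≠ 0) {Y Z : ProjPoint} (hYZ : Y.rep ⬝ᵥ W *ᵥ Z.rep = 0) :
    OnLine Y (join P X) ∨ OnLine Z (join P X) := by
  obtain ⟨d, hd0, hd⟩ := rep_mk_join hPX
  have hg := cross_rep_ne_zero hPX
  set g := P.rep ⨯₃ X.rep
  have hc : ∀ u, ∃ c : ℝ, W *ᵥ u = c • g := fun u => by
    refine exists_eq_smul_cross hg ?_ ?_
    · rw [dotProduct_mulVec_comm hW, hP, dotProduct_zero]
    · rw [dotProduct_mulVec_comm hW, hX, dotProduct_zero]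
  obtain ⟨κ, hκ⟩ := hc g
  -- By symmetry `W` is a multiple of `g gᵀ`, so conjugacy says that a product of two incidences
  -- with the line `g` vanishes.
  have hcu : ∀ u c, W *ᵥ u = c • g → c * (g ⬝ᵥ g) = κ * (u ⬝ᵥ g) := by
    intro u c h
    have := dotProduct_mulVec_comm hW g u
    rwa [h, hκ, dotProduct_smul, dotProduct_smul] at this
  have hgg := dotProduct_self_ne_zero hg
  have hκ0 : κ ≠ 0 := by
    rintro rfl
    obtain ⟨c, hcv⟩ := hc v
    have := hcu v c hcv
    rw [zero_mul, mul_eq_zero, or_iff_left hgg] at this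
    exact hv (by rw [hcv, this, zero_smul])
  simp only [onLine_iff, hd, dotProduct_smul, smul_eq_mul, mul_eq_zero, or_iff_right hd0]
  obtain ⟨c, hcZ⟩ := hc Z.rep
  rw [hcZ, dotProduct_smul, smul_eq_mul, mul_eq_zero] at hYZ
  rcases hYZ with rfl | h
  · right
    have := hcu _ _ hcZ
    rw [zero_mul, eq_comm, mul_eq_zero] at this
    exact this.resolve_left hκ0
  · exact Or.inl h

theorem RulerPoint.meet {s : Set ProjPoint} {l m : ProjLine} (hl : RulerLine s l)
    (hm : RulerLine s m) (h : l ≠ m) : RulerPoint s (meet l m) := by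
  obtain ⟨P, Q, hP, hQ, hPQ, rfl⟩ := hl
  obtain ⟨R, S, hR, hS, hRS, rfl⟩ := hm
  exact .inter hP hQ hR hS hPQ hRS h

theorem RulerLine.join {s : Set ProjPoint} {P Q : ProjPoint} (hP : RulerPoint s P)
    (hQ : RulerPoint s Q) (h : P ≠ Q) : RulerLine s (join P Q) := ⟨P, Q, hP, hQ, h, rfl⟩

/-! ### Ruler construction of conjugate lines -/

section Pencil

variable {P : ProjPoint} {W : Matrix (Fin 3) (Fin 3) ℝ}

/-- Conjugacy for `W` depends only on the lines to `P`, so points may slide along these lines. -/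
theorem IsPencilForm.dotProduct_eq_zero (hW : IsPencilForm P W) {Q Q' X X' : ProjPoint}
    (hQ : P ≠ Q) (hQ' : P ≠ Q') (hX : P ≠ X) (h : Q.rep ⬝ᵥ W *ᵥ Q'.rep = 0)
    (hXQ : OnLine X (join P Q)) (hXQ' : OnLine X' (join P Q')) : X.rep ⬝ᵥ W *ᵥ X'.rep = 0 := by
  rw [← hW.onLine_polarLine_iff (onLine_join_left hQ) hXQ hX, hW.polarLine_join hQ hQ' h]
  exact hXQ'

/-- The ruler construction of the sixth line of a quadrangular set: the line conjugate to `PT` is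
obtained from two transversals through `T`. -/
theorem IsPencilForm.rulerLine_polarLine (hW : IsPencilForm P W) {s : Set ProjPoint}
    {Q Q' S S' T : ProjPoint} {g h : ProjLine} (hPr : RulerPoint s P)
    (hQr : RulerPoint s Q) (hQr' : RulerPoint s Q') (hSr : RulerPoint s S)
    (hSr' : RulerPoint s S') (hfour : FourDistinctLines P Q Q' S S')
    (hQQ : Q.rep ⬝ᵥ W *ᵥ Q'.rep = 0) (hSS : S.rep ⬝ᵥ W *ᵥ S'.rep = 0)
    (hg : RulerLine s g) (hh : RulerLine s h) (hgh : g ≠ h) (hTg : OnLine T g) (hTh : OnLine T h)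
    (hPg : ¬ OnLine P g) (hPh : ¬ OnLine P h) : RulerLine s (polarLine P W (join P T)) := by
  obtain ⟨hPQ, hPQ', hPS, hPS', hnd⟩ := hfour
  simp only [List.nodup_cons, List.mem_cons, List.not_mem_nil, or_false, not_or, not_false_eq_true,
    List.nodup_nil, and_true] at hnd
  obtain ⟨⟨-, hQS, hQS'⟩, ⟨hQ'S, hQ'S'⟩, -⟩ := hnd
  have hPT : P ≠ T := fun e => hPg (e ▸ hTg)
  have aux : ∀ {Z : ProjPoint} {m : ProjLine}, P ≠ Z → RulerPoint s Z → RulerLine s m →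
      ¬ OnLine P m → ∃ X, RulerPoint s X ∧ P ≠ X ∧ OnLine X m ∧ OnLine X (join P Z) := by
    intro Z m hZ hZr hm hPm
    have hne : m ≠ join P Z := fun e => hPm (e ▸ onLine_join_left hZ)
    exact ⟨meet m (join P Z), .meet hm (.join hPr hZr hZ) hne,
      fun e => hPm (e ▸ meet_onLine_left hne), meet_onLine_left hne, meet_onLine_right hne⟩
  have sep : ∀ {Z Z' X X' : ProjPoint}, P ≠ Z → P ≠ Z' → P ≠ X → join P Z ≠ join P Z' →
      OnLine X (join P Z) → OnLine X' (join P Z') → X ≠ X' := by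
    rintro Z Z' X X' hZ hZ' hX hne hXZ hXZ' rfl
    exact hne (line_unique hX (onLine_join_left hZ) hXZ (onLine_join_left hZ') hXZ')
  obtain ⟨X, hXr, hPX, hXg, hXQ⟩ := aux hPQ hQr hg hPg
  obtain ⟨X', hXr', hPX', hXh, hXQ'⟩ := aux hPQ' hQr' hh hPh
  obtain ⟨Y, hYr, hPY, hYg, hYS⟩ := aux hPS hSr hg hPg
  obtain ⟨Y', hYr', hPY', hYh, hYS'⟩ := aux hPS' hSr' hh hPh
  have hXY := sep hPQ hPS hPX hQS hXQ hYS
  have hXY' := sep hPQ hPS' hPX hQS' hXQ hYS'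
  have hX'Y := sep hPQ' hPS hPX' hQ'S hXQ' hYS
  have hX'Y' := sep hPQ' hPS' hPX' hQ'S' hXQ' hYS'
  have eg := eq_join hXY hXg hYg
  have eh := eq_join hX'Y' hXh hYh
  have hne : join X Y' ≠ join X' Y := by
    intro e
    have e1 := line_unique hXY (onLine_join_left hXY') (e ▸ onLine_join_right hX'Y) hXg hYg
    have e2 := line_unique hX'Y' (e.symm ▸ onLine_join_left hX'Y) (onLine_join_right hXY') hXh hYh
    exact hgh (e1.symm.trans e2)
  -- Now `XY = g` and `X'Y' = h` meet in `T`, so Hesse's theorem makes `XY' ∧ X'Y` conjugate to `T`.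
  have key := hesse_meet hW.isSymm (hW.dotProduct_eq_zero hPQ hPQ' hPX hQQ hXQ hXQ')
    (hW.dotProduct_eq_zero hPS hPS' hPY hSS hYS hYS') hXY hX'Y' hXY' hX'Y
    (by rwa [← eg, ← eh]) hne
  rw [← eg, ← eh, ← eq_meet hgh hTg hTh] at key
  set Z := meet (join X Y') (join X' Y) with hZ
  have hZX : OnLine Z (join X Y') := meet_onLine_left hne
  have hPZ : P ≠ Z := by
    intro e
    rw [← e] at hZX
    refine hQS' ?_
    rw [← eq_join hPQ (l := join X Y') hZX ?_, ← eq_join hPS' (l := join X Y') hZX ?_]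
    · rw [line_unique hPY' hZX (onLine_join_right hXY') (onLine_join_left hPS') hYS']
      exact onLine_join_right hPS'
    · rw [line_unique hPX hZX (onLine_join_left hXY') (onLine_join_left hPQ) hXQ]
      exact onLine_join_right hPQ
  rw [hW.polarLine_join hPT hPZ key]
  exact .join hPr (.meet (.join hXr hYr' hXY') (.join hXr' hYr hX'Y) hne) hPZ

end Pencil

/-! ### Construction of the tangent from two conjugate pairs -/

section Jacobian

variable {Γ : MvPolynomial (Fin 3) ℝ} {N : Fin 3 → Matrix (Fin 3) (Fin 3) ℝ}
  {P P' : ProjPoint} {W : Matrix (Fin 3) (Fin 3) ℝ}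

/-- As `W P'` is the gradient at `P`, the points conjugate to `P'` are those of the tangent. -/
theorem IsConjPair.polarLine_join (hJ : IsJacobian Γ N) (hΓ : Γ.IsHomogeneous 3)
    (hP : IsConjPair Γ N P P') (hW : IsPencilForm P W) (hWP : W *ᵥ P'.rep = gradAt Γ P)
    {t : ProjLine} (ht : IsTangentAt Γ P t) : polarLine P W (join P P') = t := by
  obtain ⟨-, hg, e⟩ := ht
  have hPt : OnLine P t := by
    rw [e, onLine_mk, dotProduct_comm]
    exact hP.gradAt_dotProduct_rep hJ hΓ
  obtain ⟨Z, hZ, hPZ⟩ := exists_onLine_ne hPt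
  rw [eq_join hPZ hPt hZ]
  refine hW.polarLine_join hP.ne hPZ ?_
  rwa [dotProduct_mulVec_comm hW.isSymm, hWP, ← onLine_mk hg, ← e]

/-- If `PP'` is one of the four lines, its conjugate is already drawn. Otherwise two of the joins of
`P'` with `Q, Q', S, S'` serve as transversals through `P'`. They cannot all coincide, since a line
carries at most three points of the cubic. -/
theorem IsConjPair.rulerLine_tangent (hJ : IsJacobian Γ N) (hΓ : Γ.IsHomogeneous 3)
    (hirr : Irreducible Γ) (hP : IsConjPair Γ N P P') (hW : IsPencilForm P W)
    (hconj : ∀ x y, Conj N x y → x ⬝ᵥ W *ᵥ y = 0) {s : Set ProjPoint} {Q Q' S S' : ProjPoint}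
    (hQ : IsConjPair Γ N Q Q') (hS : IsConjPair Γ N S S') (hfour : FourDistinctLines P Q Q' S S')
    (hPr : RulerPoint s P) (hPr' : RulerPoint s P') (hQr : RulerPoint s Q)
    (hQr' : RulerPoint s Q') (hSr : RulerPoint s S) (hSr' : RulerPoint s S') :
    RulerLine s (polarLine P W (join P P')) := by
  have hQQ := hconj _ _ hQ.conj
  have hSS := hconj _ _ hS.conj
  have hfour' := hfour
  obtain ⟨hPQ, hPQ', hPS, hPS', hnd⟩ := hfour'
  simp only [List.nodup_cons, List.mem_cons, List.not_mem_nil, or_false, not_or, not_false_eq_true,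
    List.nodup_nil, and_true] at hnd
  obtain ⟨⟨hQQ', hQS, hQS'⟩, ⟨hQ'S, hQ'S'⟩, hSS'⟩ := hnd
  by_cases h1 : join P P' = join P Q
  · rw [h1, hW.polarLine_join hPQ hPQ' hQQ]
    exact .join hPr hQr' hPQ'
  by_cases h2 : join P P' = join P Q'
  · rw [h2, hW.polarLine_join hPQ' hPQ (by rwa [dotProduct_mulVec_comm hW.isSymm])]
    exact .join hPr hQr hPQ
  by_cases h3 : join P P' = join P S
  · rw [h3, hW.polarLine_join hPS hPS' hSS]
    exact .join hPr hSr' hPS'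
  by_cases h4 : join P P' = join P S'
  · rw [h4, hW.polarLine_join hPS' hPS (by rwa [dotProduct_mulVec_comm hW.isSymm])]
    exact .join hPr hSr hPS
  have ne_of : ∀ {X : ProjPoint}, join P P' ≠ join P X → P' ≠ X := by
    rintro X h rfl
    exact h rfl
  have off : ∀ {X : ProjPoint}, P ≠ X → join P P' ≠ join P X → ¬ OnLine P (join P' X) := by
    intro X hX h hon
    have hP'X := ne_of h
    refine h ?_
    rw [← eq_join hP.ne hon (onLine_join_left hP'X), ← eq_join hX hon (onLine_join_right hP'X)]
  have done : ∀ {X Y : ProjPoint}, P ≠ X → P ≠ Y → join P P' ≠ join P X →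
      join P P' ≠ join P Y → RulerPoint s X → RulerPoint s Y → join P' X ≠ join P' Y →
      RulerLine s (polarLine P W (join P P')) := by
    intro X Y hX hY hX' hY' hXr hYr hXY
    exact hW.rulerLine_polarLine hPr hQr hQr' hSr hSr' hfour hQQ hSS
      (.join hPr' hXr (ne_of hX')) (.join hPr' hYr (ne_of hY')) hXY
      (onLine_join_left (ne_of hX')) (onLine_join_left (ne_of hY')) (off hX hX') (off hY hY')
  by_cases k1 : join P' Q = join P' Q'
  · by_cases k2 : join P' Q = join P' S
    · by_cases k3 : join P' Q = join P' S'
      · exfalso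
        have hne : ∀ {X Y : ProjPoint}, join P X ≠ join P Y → X ≠ Y := by
          rintro X Y h rfl
          exact h rfl
        refine false_of_four_points (l := join P' Q) (P := Q) (Q := Q') (X := S) (Y := S')
          hΓ hirr ?_ (hQ.onCurve hJ) (hQ.onCurve' hJ) (hS.onCurve hJ) (hS.onCurve' hJ)
          (onLine_join_right (ne_of h1)) (k1 ▸ onLine_join_right (ne_of h2))
          (k2 ▸ onLine_join_right (ne_of h3)) (k3 ▸ onLine_join_right (ne_of h4))
        simp [hne hQQ', hne hQS, hne hQS', hne hQ'S, hne hQ'S', hne hSS']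
      · exact done hPQ hPS' h1 h4 hQr hSr' k3
    · exact done hPQ hPS h1 h3 hQr hSr k2
  · exact done hPQ hPQ' h1 h2 hQr hQr' k1

/-- Among six disjoint conjugate pairs there are two that give four distinct lines through `P`. -/
theorem IsConjPair.exists_fourDistinctLines (hJ : IsJacobian Γ N) (hΓ : Γ.IsHomogeneous 3)
    (hirr : Irreducible Γ) (hP : IsConjPair Γ N P P') (hW : IsPencilForm P W)
    (hconj : ∀ x y, Conj N x y → x ⬝ᵥ W *ᵥ y = 0) {X X' : Fin 6 → ProjPoint}
    (hX : ∀ i, IsConjPair Γ N (X i) (X' i))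
    (hd : ∀ i j, i ≠ j → X i ≠ X j ∧ X i ≠ X' j) :
    ∃ i j, FourDistinctLines P (X i) (X' i) (X j) (X' j) := by
  classical
  by_contra! hcon
  have hd' : ∀ i j, i ≠ j → X' i ≠ X j ∧ X' i ≠ X' j := by
    refine fun i j hij => ⟨fun h => (hd j i hij.symm).2 h.symm, fun h => (hd i j hij).1 ?_⟩
    have h1 := (hX i).symm hJ
    rw [h] at h1
    exact h1.unique hJ hΓ ((hX j).symm hJ)
  have hform : ∀ i, (X i).rep ⬝ᵥ W *ᵥ (X' i).rep = 0 := fun i => hconj _ _ (hX i).conj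
  have hpol : ∀ i, P ≠ X i → P ≠ X' i → polarLine P W (join P (X i)) = join P (X' i) :=
    fun i h h' => hW.polarLine_join h h' (hform i)
  have hpol' : ∀ i, P ≠ X i → P ≠ X' i → polarLine P W (join P (X' i)) = join P (X i) :=
    fun i h h' => hW.polarLine_join h' h (by rw [dotProduct_mulVec_comm hW.isSymm, hform])
  let s₁ := Finset.univ.filter fun i => P = X i ∨ P = X' i
  let s₂ := Finset.univ.filter fun i => P ≠ X i ∧ P ≠ X' i ∧ join P (X i) = join P (X' i)
  let s₃ := Finset.univ.filter fun i => P ≠ X i ∧ P ≠ X' i ∧ join P (X i) ≠ join P (X' i)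
  have hcover : (Finset.univ : Finset (Fin 6)) ⊆ s₁ ∪ (s₂ ∪ s₃) := by
    intro i _
    simp only [s₁, s₂, s₃, Finset.mem_union, Finset.mem_filter, Finset.mem_univ, true_and]
    tauto
  have h1 : s₁.card ≤ 1 := by
    rw [Finset.card_le_one]
    intro i hi j hj
    simp only [s₁, Finset.mem_filter, Finset.mem_univ, true_and] at hi hj
    by_contra hij
    have := hd i j hij
    have := hd' i j hij
    grind
  -- An involution has at most two fixed lines: the quadratic form of `W` would vanish at `X i`, `X
  -- j` and a third point `Z` of their join, making `X i` and `X j` conjugate and the fixed line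
  -- `PXᵢ` equal to `PXⱼ`.
  have h2 : s₂.card ≤ 2 := by
    by_contra! hlt
    obtain ⟨i, hi, j, hj, k, hk, hij, hik, hjk⟩ := Finset.two_lt_card.mp hlt
    simp only [s₂, Finset.mem_filter, Finset.mem_univ, true_and] at hi hj hk
    have hself : ∀ m, P ≠ X m ∧ P ≠ X' m ∧ join P (X m) = join P (X' m) → ∀ Z, P ≠ Z →
        OnLine Z (join P (X m)) → Z.rep ⬝ᵥ W *ᵥ Z.rep = 0 := by
      rintro m ⟨hm, hm', he⟩ Z hPZ hZ
      exact hW.dotProduct_eq_zero hm hm' hPZ (hform m) hZ (he ▸ hZ)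
    have hoff : ∀ m n, m ≠ n → P ≠ X m ∧ P ≠ X' m ∧ join P (X m) = join P (X' m) →
        P ≠ X n → ¬ OnLine (X n) (join P (X m)) := by
      rintro m n hmn ⟨hm, hm', he⟩ hn hon
      refine false_of_four_points (l := join P (X m)) (P := P) (Q := X m) (X := X' m) (Y := X n)
        hΓ hirr ?_ (hP.onCurve hJ) ((hX m).onCurve hJ) ((hX m).onCurve' hJ) ((hX n).onCurve hJ)
        (onLine_join_left hm) (onLine_join_right hm) (he ▸ onLine_join_right hm') hon
      simp [hm, hm', hn, (hX m).ne, (hd m n hmn).1, (hd' m n hmn).1]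
    have hXij := (hd i j hij).1
    have hPij : ¬ OnLine P (join (X i) (X j)) := by
      intro hon
      refine hoff i j hij hi hj.1 ?_
      rw [← eq_join hi.1 hon (onLine_join_left hXij)]
      exact onLine_join_right hXij
    have hne : join (X i) (X j) ≠ join P (X k) := fun e => hPij (e ▸ onLine_join_left hk.1)
    set Z := meet (join (X i) (X j)) (join P (X k))
    have hZ1 : OnLine Z (join (X i) (X j)) := meet_onLine_left hne
    have hZ2 : OnLine Z (join P (X k)) := meet_onLine_right hne
    have hPZ : P ≠ Z := fun e => hPij (e ▸ hZ1)
    have hZi : Z ≠ X i := fun e => hoff k i hik.symm hk hi.1 (e ▸ hZ2)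
    have hZj : Z ≠ X j := fun e => hoff k j hjk.symm hk hj.1 (e ▸ hZ2)
    obtain ⟨a, b, hab⟩ := exists_rep_eq_of_onLine hXij (onLine_join_left hXij)
      (onLine_join_right hXij) hZ1
    have ha := rep_eq_smul_add_smul_ne_zero hab hZj
    have hb := rep_eq_smul_add_smul_ne_zero (hab.trans (add_comm _ _)) hZi
    have hz := hself k hk Z hPZ hZ2
    rw [hab] at hz
    simp only [Matrix.mulVec_add, Matrix.mulVec_smul, dotProduct_add, add_dotProduct,
      dotProduct_smul, smul_dotProduct, smul_eq_mul,
      hself i hi _ hi.1 (onLine_join_right hi.1), hself j hj _ hj.1 (onLine_join_right hj.1),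
      dotProduct_mulVec_comm hW.isSymm (X j).rep (X i).rep] at hz
    have hzero : (X i).rep ⬝ᵥ W *ᵥ (X j).rep = 0 := by
      have : (a * b) * ((X i).rep ⬝ᵥ W *ᵥ (X j).rep) = 0 := by linarith
      exact (mul_eq_zero.mp this).resolve_left (mul_ne_zero ha hb)
    refine hoff i j hij hi hj.1 ?_
    rw [hi.2.2, ← hpol i hi.1 hi.2.1, hW.polarLine_join hi.1 hj.1 hzero]
    exact onLine_join_right hj.1
  -- If no two pairs give four distinct lines, each further pair in `s₃` has a point on `PXᵢ`. With
  -- three such pairs this line would carry four points of the cubic.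
  have h3 : s₃.card ≤ 2 := by
    by_contra! hlt
    obtain ⟨i, hi, j, hj, k, hk, hij, hik, hjk⟩ := Finset.two_lt_card.mp hlt
    simp only [s₃, Finset.mem_filter, Finset.mem_univ, true_and] at hi hj hk
    have hon : ∀ m, P ≠ X m ∧ P ≠ X' m ∧ join P (X m) ≠ join P (X' m) →
        ∃ Y, (Y = X m ∨ Y = X' m) ∧ P ≠ Y ∧ OnLine Y (join P (X i)) := by
      rintro m ⟨hm, hm', he⟩
      by_contra! hno
      refine hcon i m ⟨hi.1, hi.2.1, hm, hm', ?_⟩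
      have n1 : join P (X i) ≠ join P (X m) := fun e =>
        hno _ (Or.inl rfl) hm (e ▸ onLine_join_right hm)
      have n2 : join P (X i) ≠ join P (X' m) := fun e =>
        hno _ (Or.inr rfl) hm' (e ▸ onLine_join_right hm')
      have n3 : join P (X' i) ≠ join P (X m) := fun e => n2 (by
        rw [← hpol' i hi.1 hi.2.1, e, hpol m hm hm'])
      have n4 : join P (X' i) ≠ join P (X' m) := fun e => n1 (by
        rw [← hpol' i hi.1 hi.2.1, e, hpol' m hm hm'])
      simp [hi.2.2, he, n1, n2, n3, n4]
    obtain ⟨Y, hY, hPY, hYi⟩ := hon j hj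
    obtain ⟨Z, hZ, hPZ, hZi⟩ := hon k hk
    have hYΓ : OnCurve Γ Y := by
      rcases hY with rfl | rfl
      exacts [(hX j).onCurve hJ, (hX j).onCurve' hJ]
    have hZΓ : OnCurve Γ Z := by
      rcases hZ with rfl | rfl
      exacts [(hX k).onCurve hJ, (hX k).onCurve' hJ]
    have hiY : X i ≠ Y := by
      rcases hY with rfl | rfl
      exacts [(hd i j hij).1, (hd i j hij).2]
    have hiZ : X i ≠ Z := by
      rcases hZ with rfl | rfl
      exacts [(hd i k hik).1, (hd i k hik).2]
    have hYZ : Y ≠ Z := by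
      rcases hY with rfl | rfl <;> rcases hZ with rfl | rfl
      exacts [(hd j k hjk).1, (hd j k hjk).2, (hd' j k hjk).1, (hd' j k hjk).2]
    refine false_of_four_points (l := join P (X i)) (P := P) (Q := X i) (X := Y) (Y := Z)
        hΓ hirr ?_ (hP.onCurve hJ) ((hX i).onCurve hJ) hYΓ hZΓ
        (onLine_join_left hi.1) (onLine_join_right hi.1) hYi hZi
    simp [hi.1, hPY, hPZ, hiY, hiZ, hYZ]
  have hcard := Finset.card_le_card hcover
  have := Finset.card_union_le s₁ (s₂ ∪ s₃)
  have := Finset.card_union_le s₂ s₃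
  rw [Finset.card_univ, Fintype.card_fin] at hcard
  omega

end Jacobian

/-! ### Schroeter's configuration on an irreducible cubic -/

/-- Three pairs of points on an irreducible cubic, and the third intersection points `D`, `E`, `F` of
the cubic with the lines that join them. -/
structure IsSchroeterConfig (Γ : MvPolynomial (Fin 3) ℝ) (A A' B B' C C' D E F : ProjPoint) :
    Prop where
  homogeneous : Γ.IsHomogeneous 3
  irreducible : Irreducible Γ
  nodup : [A, A', B, B', C, C', D, E, F].Nodup
  onCurve : ∀ X ∈ [A, A', B, B', C, C', D, E, F], OnCurve Γ X
  onLine_D : OnLine D (join A B)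
  onLine_D' : OnLine D (join A' B')
  onLine_E : OnLine E (join B C)
  onLine_E' : OnLine E (join B' C')
  onLine_F : OnLine F (join C A)
  onLine_F' : OnLine F (join C' A')

namespace IsSchroeterConfig

variable {Γ : MvPolynomial (Fin 3) ℝ} {A A' B B' C C' D E F : ProjPoint}

/-- Together with `swap`, this symmetry reduces statements about all sides to the side `AB`. -/
theorem rotate (h : IsSchroeterConfig Γ A A' B B' C C' D E F) :
    IsSchroeterConfig Γ B B' C C' A A' E F D := by
  obtain ⟨h1, h2, h3, h4, h5, h6, h7, h8, h9, h10⟩ := h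
  have hp : [A, A', B, B', C, C', D, E, F].Perm [B, B', C, C', A, A', E, F, D] :=
    (List.perm_append_comm (l₁ := [A, A']) (l₂ := [B, B', C, C'])).append
      (List.perm_append_comm (l₁ := [D]) (l₂ := [E, F]))
  exact ⟨h1, h2, hp.nodup_iff.mp h3, fun X hX => h4 X (hp.mem_iff.mpr hX), h7, h8, h9, h10, h5, h6⟩

theorem swap (h : IsSchroeterConfig Γ A A' B B' C C' D E F) :
    IsSchroeterConfig Γ A' A B' B C' C D E F := by
  obtain ⟨h1, h2, h3, h4, h5, h6, h7, h8, h9, h10⟩ := h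
  have hp : [A, A', B, B', C, C', D, E, F].Perm [A', A, B', B, C', C, D, E, F] :=
    (List.Perm.swap _ _ _).trans (((List.Perm.swap _ _ _).trans
      (((List.Perm.swap _ _ _).cons _).cons _)).cons _ |>.cons _)
  exact ⟨h1, h2, hp.nodup_iff.mp h3, fun X hX => h4 X (hp.mem_iff.mpr hX), h6, h5, h8, h7, h10, h9⟩

theorem A_ne_B (h : IsSchroeterConfig Γ A A' B B' C C' D E F) : A ≠ B := by
  have := h.nodup
  simp at this
  tauto

/-- The line `AB` meets the cubic only in `A`, `B` and `D`. -/
theorem eq_of_onLine (h : IsSchroeterConfig Γ A A' B B' C C' D E F) {l : ProjLine} {X : ProjPoint}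
    (hA : OnLine A l) (hB : OnLine B l) (hX : OnLine X l) (hXΓ : OnCurve Γ X) :
    X = A ∨ X = B ∨ X = D := by
  by_contra! hne
  have hnd := h.nodup
  have hD := h.onLine_D
  rw [← eq_join h.A_ne_B hA hB] at hD
  refine false_of_four_points h.homogeneous h.irreducible (P := A) (Q := B) (X := D) (Y := X) ?_
    (h.onCurve A (by simp)) (h.onCurve B (by simp)) (h.onCurve D (by simp)) hXΓ hA hB hD hX
  simp at hnd ⊢
  have := hne.1.symm
  have := hne.2.1.symm
  have := hne.2.2.symm
  tauto

theorem not_onLine (h : IsSchroeterConfig Γ A A' B B' C C' D E F) {X : ProjPoint}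
    (hX : X ∈ [A', B', C, C', E, F]) : ¬ OnLine X (join A B) := by
  intro hon
  have hnd := h.nodup
  have := h.eq_of_onLine (onLine_join_left h.A_ne_B) (onLine_join_right h.A_ne_B) hon
    (h.onCurve X (by simp at hX ⊢; tauto))
  simp at hX hnd
  rcases hX with rfl | rfl | rfl | rfl | rfl | rfl <;> tauto

/-- Of three points taken from the three pairs, two are both primed or both unprimed. Their join
meets the cubic again only in `D`, `E` or `F`, so it misses the third pair. This rules out
polarities of rank one. -/
theorem not_onLine_triple (h : IsSchroeterConfig Γ A A' B B' C C' D E F) {l : ProjLine}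
    (hA : OnLine A l ∨ OnLine A' l) (hB : OnLine B l ∨ OnLine B' l)
    (hC : OnLine C l ∨ OnLine C' l) : False := by
  have key : ∀ {A A' B B' C C' D E F : ProjPoint}, IsSchroeterConfig Γ A A' B B' C C' D E F →
      OnLine A l → OnLine B l → (OnLine C l ∨ OnLine C' l) → False := by
    intro A A' B B' C C' D E F h hA hB hC
    rw [eq_join h.A_ne_B hA hB] at hC
    exact hC.elim (h.not_onLine (by simp)) (h.not_onLine (by simp))
  rcases hA with hA | hA <;> rcases hB with hB | hB
  · exact key h hA hB hC
  · rcases hC with hC | hC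
    · exact key h.rotate.rotate hC hA (Or.inr hB)
    · exact key h.swap.rotate hB hC (Or.inr hA)
  · rcases hC with hC | hC
    · exact key h.rotate hB hC (Or.inr hA)
    · exact key h.swap.rotate.rotate hC hA (Or.inr hB)
  · exact key h.swap hA hB hC.symm

theorem triple_ne_zero {P Q X : ProjPoint} (h : P ≠ Q) (hX : ¬ OnLine X (join P Q)) :
    X.rep ⬝ᵥ (P.rep ⨯₃ Q.rep) ≠ 0 := by
  obtain ⟨c, -, hc⟩ := rep_mk_join h
  intro h0
  exact hX (onLine_iff.mpr (by rw [hc, dotProduct_smul, h0, smul_zero]))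

theorem triple_eq_zero {P Q X : ProjPoint} (h : P ≠ Q) (hX : OnLine X (join P Q)) :
    X.rep ⬝ᵥ (P.rep ⨯₃ Q.rep) = 0 := by
  obtain ⟨c, hc0, hc⟩ := rep_mk_join h
  rw [onLine_iff, hc, dotProduct_smul, smul_eq_mul] at hX
  exact (mul_eq_zero.mp hX).resolve_left hc0

theorem exists_relation (h : IsSchroeterConfig Γ A A' B B' C C' D E F) :
    ∃ s t : ℝ, t ≠ 0 ∧ D.rep = s • A.rep + t • B.rep ∧
      s * (grad Γ A.rep ⬝ᵥ B.rep) + t * (grad Γ B.rep ⬝ᵥ A.rep) = 0 := by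
  have hnd := h.nodup
  simp at hnd
  obtain ⟨s, t, hst⟩ := exists_rep_eq_of_onLine h.A_ne_B (onLine_join_left h.A_ne_B)
    (onLine_join_right h.A_ne_B) h.onLine_D
  have hs := rep_eq_smul_add_smul_ne_zero hst (by tauto)
  have ht := rep_eq_smul_add_smul_ne_zero (hst.trans (add_comm _ _)) (by tauto)
  exact ⟨s, t, ht, hst, third_point_relation h.homogeneous hst hs ht (h.onCurve A (by simp))
    (h.onCurve B (by simp)) (h.onCurve D (by simp))⟩

theorem exists_isJacobian (h : IsSchroeterConfig Γ A A' B B' C C' D E F) :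
    ∃ N, IsJacobian Γ N ∧ Conj N A.rep A'.rep ∧ Conj N B.rep B'.rep ∧ Conj N C.rep C'.rep := by
  obtain ⟨s, t, ht, hst, hrel⟩ := h.exists_relation
  obtain ⟨s₁, t₁, ht₁, hst₁, hrel₁⟩ := h.rotate.exists_relation
  obtain ⟨s₂, t₂, ht₂, hst₂, hrel₂⟩ := h.rotate.rotate.exists_relation
  have hAB := h.A_ne_B
  have hBC := h.rotate.A_ne_B
  have hCA := h.rotate.rotate.A_ne_B
  have hAB' := h.swap.A_ne_B
  have hBC' := h.swap.rotate.A_ne_B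
  have hCA' := h.swap.rotate.rotate.A_ne_B
  exact _root_.exists_isJacobian h.homogeneous (h.onCurve A (by simp)) (h.onCurve B (by simp))
    (h.onCurve C (by simp)) (h.onCurve A' (by simp)) (h.onCurve B' (by simp))
    (h.onCurve C' (by simp))
    (triple_ne_zero hBC (h.rotate.not_onLine (by simp)))
    (triple_ne_zero hBC' (h.swap.rotate.not_onLine (by simp)))
    (triple_ne_zero hBC (h.rotate.not_onLine (by simp)))
    (triple_ne_zero hCA (h.rotate.rotate.not_onLine (by simp)))
    (triple_ne_zero hAB (h.not_onLine (by simp)))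
    (triple_ne_zero hBC (h.rotate.not_onLine (by simp)))
    (triple_ne_zero hCA (h.rotate.rotate.not_onLine (by simp)))
    (triple_ne_zero hAB (h.not_onLine (by simp)))
    (triple_ne_zero hBC (h.rotate.not_onLine (by simp)))
    (triple_ne_zero hCA (h.rotate.rotate.not_onLine (by simp)))
    (triple_ne_zero hAB (h.not_onLine (by simp)))
    (triple_ne_zero hAB' (h.swap.not_onLine (by simp)))
    (triple_ne_zero hBC' (h.swap.rotate.not_onLine (by simp)))
    (triple_ne_zero hCA' (h.swap.rotate.rotate.not_onLine (by simp)))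
    ht ht₁ ht₂ hst hst₁ hst₂ (triple_eq_zero hAB' h.onLine_D')
    (triple_eq_zero hBC' h.onLine_E') (triple_eq_zero hCA' h.onLine_F') hrel hrel₁ hrel₂

theorem gradAt_ne_zero (h : IsSchroeterConfig Γ A A' B B' C C' D E F) : gradAt Γ A ≠ 0 := by
  have hnd := h.nodup
  simp at hnd
  exact gradAt_ne_zero_of_three_points h.homogeneous h.irreducible (Q := B) (X := D)
    (l := join A B) (by tauto) (by tauto) (by tauto) (h.onCurve A (by simp))
    (h.onCurve B (by simp)) (h.onCurve D (by simp)) (onLine_join_left h.A_ne_B)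
    (onLine_join_right h.A_ne_B) h.onLine_D

theorem isConjPair (h : IsSchroeterConfig Γ A A' B B' C C' D E F)
    {N : Fin 3 → Matrix (Fin 3) (Fin 3) ℝ} (hA : Conj N A.rep A'.rep) : IsConjPair Γ N A A' := by
  have hnd := h.nodup
  simp at hnd
  exact ⟨by tauto, hA, h.gradAt_ne_zero, h.swap.gradAt_ne_zero⟩

end IsSchroeterConfig

/-! ### Schroeter pairs are conjugate pairs -/

theorem gradAt_ne_zero_meet {Γ : MvPolynomial (Fin 3) ℝ} (hΓ : Γ.IsHomogeneous 3)
    (hirr : Irreducible Γ) {P Q X : ProjPoint} {l : ProjLine} (hPQ : P ≠ Q) (hP : OnCurve Γ P)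
    (hQ : OnCurve Γ Q) (hX : OnCurve Γ X) (hPl : OnLine P l) (hQl : OnLine Q l) (hXl : OnLine X l)
    (hPg : gradAt Γ P ≠ 0) (hQg : gradAt Γ Q ≠ 0) : gradAt Γ X ≠ 0 := by
  by_cases h1 : X = P
  · rwa [h1]
  by_cases h2 : X = Q
  · rwa [h2]
  exact gradAt_ne_zero_of_three_points hΓ hirr h1 h2 hPQ hX hP hQ hXl hPl hQl

/-- The two points constructed from two pairs of distinct points are distinct. -/
theorem meet_ne_meet {P P' Q Q' : ProjPoint} (hP : P ≠ P') (hQ : Q ≠ Q')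
    (h1 : P ≠ Q) (h2 : P' ≠ Q') (h3 : P ≠ Q') (h4 : P' ≠ Q)
    (h5 : join P Q ≠ join P' Q') (h6 : join P Q' ≠ join P' Q) :
    meet (join P Q) (join P' Q') ≠ meet (join P Q') (join P' Q) := by
  intro e
  have x1 := meet_onLine_left h5
  have x2 := meet_onLine_right h5
  have x3 := meet_onLine_left h6
  have x4 := meet_onLine_right h6
  rw [← e] at x3 x4
  set X := meet (join P Q) (join P' Q')
  by_cases hXP : X = P
  · rw [hXP] at x2 x4
    have e1 := line_unique hP x2 (onLine_join_left h2) x4 (onLine_join_left h4)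
    refine h5 (line_unique hQ (onLine_join_right h1) ?_ ?_ (onLine_join_right h2))
    · rw [← line_unique h1 x4 (onLine_join_right h4) (onLine_join_left h1) (onLine_join_right h1),
        ← e1]
      exact onLine_join_right h2
    · rw [e1]
      exact onLine_join_right h4
  · have e1 := line_unique hXP x1 (onLine_join_left h1) x3 (onLine_join_left h3)
    by_cases hXP' : X = P'
    · rw [hXP'] at x1 x3
      refine h6 ?_
      rw [← e1]
      exact line_unique h4 x1 (onLine_join_right h1) (onLine_join_left h4) (onLine_join_right h4)
    · have e2 := line_unique hXP' x2 (onLine_join_left h2) x4 (onLine_join_left h4)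
      refine h5 (line_unique hQ (onLine_join_right h1) ?_ ?_ (onLine_join_right h2))
      · rw [e1]
        exact onLine_join_right h3
      · rw [e2]
        exact onLine_join_right h4

section Jacobian

variable {Γ : MvPolynomial (Fin 3) ℝ} {N : Fin 3 → Matrix (Fin 3) (Fin 3) ℝ}

theorem IsConjPair.step (hJ : IsJacobian Γ N) (hΓ : Γ.IsHomogeneous 3) (hirr : Irreducible Γ)
    {P P' Q Q' : ProjPoint} (hP : IsConjPair Γ N P P') (hQ : IsConjPair Γ N Q Q')
    (h1 : P ≠ Q) (h2 : P' ≠ Q') (h3 : P ≠ Q') (h4 : P' ≠ Q)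
    (h5 : join P Q ≠ join P' Q') (h6 : join P Q' ≠ join P' Q) :
    IsConjPair Γ N (meet (join P Q) (join P' Q')) (meet (join P Q') (join P' Q)) := by
  have hc : Conj N (meet (join P Q) (join P' Q')).rep (meet (join P Q') (join P' Q)).rep :=
    fun i => hesse_meet (hJ.isSymm i) (hP.conj i) (hQ.conj i) h1 h2 h3 h4 h5 h6
  refine ⟨meet_ne_meet hP.ne hQ.ne h1 h2 h3 h4 h5 h6, hc, ?_, ?_⟩
  · exact gradAt_ne_zero_meet hΓ hirr h1 (hP.onCurve hJ) (hQ.onCurve hJ)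
      (hJ.eval_eq_zero hc (Projectivization.rep_nonzero _)) (onLine_join_left h1)
      (onLine_join_right h1) (meet_onLine_left h5) hP.gradAt_ne_zero hQ.gradAt_ne_zero
  · exact gradAt_ne_zero_meet hΓ hirr h3 (hP.onCurve hJ) (hQ.onCurve' hJ)
      (hJ.eval_eq_zero (hc.symm hJ) (Projectivization.rep_nonzero _)) (onLine_join_left h3)
      (onLine_join_right h3) (meet_onLine_left h6) hP.gradAt_ne_zero hQ.gradAt_ne_zero'

theorem SchroeterPair.isConjPair (hJ : IsJacobian Γ N) (hΓ : Γ.IsHomogeneous 3)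
    (hirr : Irreducible Γ) {A A' B B' C C' P P' : ProjPoint} (hA : IsConjPair Γ N A A')
    (hB : IsConjPair Γ N B B') (hC : IsConjPair Γ N C C')
    (h : SchroeterPair A A' B B' C C' P P') : IsConjPair Γ N P P' := by
  induction h with
  | baseA => exact hA
  | baseB => exact hB
  | baseC => exact hC
  | symm _ ih => exact ih.symm hJ
  | step _ _ h1 h2 h3 h4 h5 h6 ih1 ih2 => exact ih1.step hJ hΓ hirr ih2 h1 h2 h3 h4 h5 h6

end Jacobian

theorem SchroeterPair.rulerPoint {A A' B B' C C' P P' : ProjPoint}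
    (h : SchroeterPair A A' B B' C C' P P') : RulerPoint {A, A', B, B', C, C'} P ∧
      RulerPoint {A, A', B, B', C, C'} P' := by
  induction h with
  | baseA => exact ⟨.given (by simp), .given (by simp)⟩
  | baseB => exact ⟨.given (by simp), .given (by simp)⟩
  | baseC => exact ⟨.given (by simp), .given (by simp)⟩
  | symm _ ih => exact ih.symm
  | step _ _ h1 h2 h3 h4 h5 h6 ih1 ih2 =>
    exact ⟨.inter ih1.1 ih2.1 ih1.2 ih2.2 h1 h2 h5, .inter ih1.1 ih2.2 ih1.2 ih2.1 h3 h4 h6⟩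

namespace IsSchroeterConfig

variable {Γ : MvPolynomial (Fin 3) ℝ} {A A' B B' C C' D E F : ProjPoint}

theorem join_ne_join (h : IsSchroeterConfig Γ A A' B B' C C' D E F) :
    A ≠ B' ∧ A' ≠ B ∧ join A B ≠ join A' B' ∧ join A B' ≠ join A' B := by
  have hnd := h.nodup
  simp at hnd
  have h1 : A ≠ B' := by tauto
  have h2 : A' ≠ B := by tauto
  refine ⟨h1, h2, fun e => ?_, fun e => ?_⟩
  · exact h.not_onLine (X := A') (by simp) (e ▸ onLine_join_left h.swap.A_ne_B)
  · refine h.not_onLine (X := A') (by simp) ?_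
    rw [← eq_join h.A_ne_B (onLine_join_left h1) (e ▸ onLine_join_right h2), e]
    exact onLine_join_left h2

/-- If the partner `AB' ∧ A'B` of `D` were `E`, the line `A'B` would be `BC`, which does not contain
`A'`; similarly for `F`. -/
theorem meet_ne_and_eq_meet (h : IsSchroeterConfig Γ A A' B B' C C' D E F) :
    meet (join A B') (join A' B) ≠ E ∧ meet (join A B') (join A' B) ≠ F ∧
      D = meet (join A B) (join A' B') := by
  obtain ⟨h1, h2, h3, h4⟩ := h.join_ne_join
  have hnd := h.nodup
  simp at hnd
  refine ⟨?_, ?_, eq_meet h3 h.onLine_D h.onLine_D'⟩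
  · intro e
    have hE := meet_onLine_right h4
    rw [e] at hE
    have hne : E ≠ B := by tauto
    refine h.rotate.not_onLine (X := A') (by simp) ?_
    rw [line_unique hne h.onLine_E (onLine_join_left h.rotate.A_ne_B) hE (onLine_join_right h2)]
    exact onLine_join_left h2
  · intro e
    have hF := meet_onLine_left h4
    rw [e] at hF
    have hne : F ≠ A := by tauto
    refine h.rotate.rotate.not_onLine (X := B') (by simp) ?_
    rw [line_unique hne h.onLine_F (onLine_join_right h.rotate.rotate.A_ne_B) hF
      (onLine_join_left h1)]
    exact onLine_join_right h1

/-- The pairs are the given ones and those of `D`, `E`, `F`. The nine points are distinct, and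
coincidences with the new partners are excluded by uniqueness of partners and `meet_ne_and_eq_meet`.
-/
theorem exists_six_pairs (h : IsSchroeterConfig Γ A A' B B' C C' D E F)
    {N : Fin 3 → Matrix (Fin 3) (Fin 3) ℝ} (hJ : IsJacobian Γ N)
    (hS : ∀ {P P'}, SchroeterPair A A' B B' C C' P P' → IsConjPair Γ N P P') :
    ∃ X X' : Fin 6 → ProjPoint, (∀ i, SchroeterPair A A' B B' C C' (X i) (X' i)) ∧
      ∀ i j, i ≠ j → X i ≠ X j ∧ X i ≠ X' j := by
  obtain ⟨a1, a2, a3, a4⟩ := h.join_ne_join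
  obtain ⟨b1, b2, b3, b4⟩ := h.rotate.join_ne_join
  obtain ⟨c1, c2, c3, c4⟩ := h.rotate.rotate.join_ne_join
  obtain ⟨dE, dF, eD⟩ := h.meet_ne_and_eq_meet
  obtain ⟨eF, eD', eE⟩ := h.rotate.meet_ne_and_eq_meet
  obtain ⟨fD, fE, eF'⟩ := h.rotate.rotate.meet_ne_and_eq_meet
  have pD := SchroeterPair.step (.baseA (A := A) (A' := A') (B := B) (B' := B') (C := C) (C' := C'))
    .baseB h.A_ne_B h.swap.A_ne_B a1 a2 a3 a4
  have pE := SchroeterPair.step (.baseB (A := A) (A' := A') (B := B) (B' := B') (C := C) (C' := C'))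
    .baseC h.rotate.A_ne_B h.swap.rotate.A_ne_B b1 b2 b3 b4
  have pF := SchroeterPair.step (.baseC (A := A) (A' := A') (B := B) (B' := B') (C := C) (C' := C'))
    .baseA h.rotate.rotate.A_ne_B h.swap.rotate.rotate.A_ne_B c1 c2 c3 c4
  rw [← eD] at pD
  rw [← eE] at pE
  rw [← eF'] at pF
  generalize meet (join A B') (join A' B) = D' at *
  generalize meet (join B C') (join B' C) = E' at *
  generalize meet (join C A') (join C' A) = F' at *
  have hnd := h.nodup
  have hpart : ∀ {X X' Y Y' : ProjPoint}, SchroeterPair A A' B B' C C' X X' →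
      SchroeterPair A A' B B' C C' Y Y' → X' ≠ Y → X ≠ Y' := by
    rintro X X' Y Y' hX hY hne rfl
    exact hne ((hS hX).unique hJ h.homogeneous ((hS hY).symm hJ))
  refine ⟨![A, B, C, D, E, F], ![A', B', C', D', E', F'], ?_, ?_⟩
  · intro i
    fin_cases i
    exacts [.baseA, .baseB, .baseC, pD, pE, pF]
  · simp only [List.nodup_cons, List.mem_cons, List.not_mem_nil, or_false, not_or,
      not_false_eq_true, List.nodup_nil, and_true] at hnd
    have kA : ∀ {Y Y'}, SchroeterPair A A' B B' C C' Y Y' → A' ≠ Y → A ≠ Y' := hpart .baseA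
    have kB : ∀ {Y Y'}, SchroeterPair A A' B B' C C' Y Y' → B' ≠ Y → B ≠ Y' := hpart .baseB
    have kC : ∀ {Y Y'}, SchroeterPair A A' B B' C C' Y Y' → C' ≠ Y → C ≠ Y' := hpart .baseC
    have := kA pD (by tauto)
    have := kA pE (by tauto)
    have := kA pF (by tauto)
    have := kB pD (by tauto)
    have := kB pE (by tauto)
    have := kB pF (by tauto)
    have := kC pD (by tauto)
    have := kC pE (by tauto)
    have := kC pF (by tauto)
    clear hpart kA kB kC hS pD pE pF
    intro i j hij
    fin_cases i <;> fin_cases j <;> first | exact absurd rfl hij | (simp; grind)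

/-- A polarity of the net that is singular at `P` is singular only there. -/
theorem isPencilForm (h : IsSchroeterConfig Γ A A' B B' C C' D E F) {P : ProjPoint}
    {W : Matrix (Fin 3) (Fin 3) ℝ} (hW : W.IsSymm) (hP : W *ᵥ P.rep = 0) {v : Fin 3 → ℝ}
    (hv : W *ᵥ v ≠ 0) (hA : A.rep ⬝ᵥ W *ᵥ A'.rep = 0) (hB : B.rep ⬝ᵥ W *ᵥ B'.rep = 0)
    (hC : C.rep ⬝ᵥ W *ᵥ C'.rep = 0) : IsPencilForm P W := by
  refine ⟨hW, hP, fun X hX => ?_⟩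
  by_contra hne
  have key : ∀ {Y Z : ProjPoint}, Y.rep ⬝ᵥ W *ᵥ Z.rep = 0 → _ :=
    fun hYZ => onLine_or_onLine_of_mulVec_eq_zero hW hP hX (Ne.symm hne) hv hYZ
  exact h.not_onLine_triple (key hA) (key hB) (key hC)

end IsSchroeterConfig

/-- The lines to be intersected are distinct, since otherwise four points of the cubic would be
collinear; so `D`, `E`, `F` are genuine intersection points. -/
theorem IsSchroeterConfig.of_meet {Γ : MvPolynomial (Fin 3) ℝ} {A A' B B' C C' D E F : ProjPoint}
    (hD : D = meet (join A B) (join A' B')) (hE : E = meet (join B C) (join B' C'))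
    (hF : F = meet (join C A) (join C' A'))
    (hnd : [A, A', B, B', C, C', D, E, F].Nodup) (hcubic : Γ.IsHomogeneous 3)
    (hirr : Irreducible Γ) (hΓ : ∀ X ∈ [A, A', B, B', C, C', D, E, F], OnCurve Γ X) :
    IsSchroeterConfig Γ A A' B B' C C' D E F := by
  have key : ∀ {P P' Q Q' : ProjPoint}, [P, P', Q, Q'].Nodup → OnCurve Γ P → OnCurve Γ P' →
      OnCurve Γ Q → OnCurve Γ Q' → join P Q ≠ join P' Q' := by
    intro P P' Q Q' hn hP hP' hQ hQ' e
    have hn' := hn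
    simp only [List.nodup_cons, List.mem_cons, List.not_mem_nil, or_false, not_or,
      not_false_eq_true, List.nodup_nil, and_true] at hn'
    obtain ⟨⟨-, h1, -⟩, ⟨-, h2⟩, -⟩ := hn'
    exact false_of_four_points hcubic hirr hn hP hP' hQ hQ' (onLine_join_left h1)
      (e ▸ onLine_join_left h2) (onLine_join_right h1) (e ▸ onLine_join_right h2)
  have hnd' := hnd
  simp only [List.nodup_cons, List.mem_cons, List.not_mem_nil, or_false, not_or,
    not_false_eq_true, List.nodup_nil, and_true] at hnd'
  have hA := hΓ A (by simp)
  have hA' := hΓ A' (by simp)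
  have hB := hΓ B (by simp)
  have hB' := hΓ B' (by simp)
  have hC := hΓ C (by simp)
  have hC' := hΓ C' (by simp)
  have nD : join A B ≠ join A' B' := key (by simp; tauto) hA hA' hB hB'
  have nE : join B C ≠ join B' C' := key (by simp; tauto) hB hB' hC hC'
  have nF : join C A ≠ join C' A' := key (by simp; grind) hC hC' hA hA'
  exact ⟨hcubic, hirr, hnd, hΓ, hD ▸ meet_onLine_left nD, hD ▸ meet_onLine_right nD,
    hE ▸ meet_onLine_left nE, hE ▸ meet_onLine_right nE, hF ▸ meet_onLine_left nF,
    hF ▸ meet_onLine_right nF⟩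

theorem IsConjPair.isTangentAt {Γ : MvPolynomial (Fin 3) ℝ}
    {N : Fin 3 → Matrix (Fin 3) (Fin 3) ℝ} (hJ : IsJacobian Γ N) {P P' : ProjPoint}
    (h : IsConjPair Γ N P P') :
    IsTangentAt Γ P (Projectivization.mk ℝ (gradAt Γ P) h.gradAt_ne_zero) :=
  ⟨h.onCurve hJ, h.gradAt_ne_zero, rfl⟩

/-- The tangent at a Schroeter point is obtained by a line involution and by ruler. -/
theorem IsSchroeterConfig.tangent {Γ : MvPolynomial (Fin 3) ℝ}
    {A A' B B' C C' D E F : ProjPoint} (h : IsSchroeterConfig Γ A A' B B' C C' D E F)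
    {N : Fin 3 → Matrix (Fin 3) (Fin 3) ℝ} (hJ : IsJacobian Γ N)
    (hS : ∀ {P P'}, SchroeterPair A A' B B' C C' P P' → IsConjPair Γ N P P')
    {P P' : ProjPoint} (hP : SchroeterPair A A' B B' C C' P P') {t : ProjLine}
    (ht : IsTangentAt Γ P t) :
    (∃ Q Q' S S' : ProjPoint, SchroeterPair A A' B B' C C' Q Q' ∧
      SchroeterPair A A' B B' C C' S S' ∧ FourDistinctLines P Q Q' S S') ∧
    (∀ Q Q' S S' : ProjPoint, SchroeterPair A A' B B' C C' Q Q' →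
      SchroeterPair A A' B B' C C' S S' → FourDistinctLines P Q Q' S S' →
      (∃ Λ, IsLineInvolutionGivenBy P Q Q' S S' Λ) ∧
      ∀ Λ, IsLineInvolutionGivenBy P Q Q' S S' Λ → Λ (join P P') = t) ∧
    RulerLine {A, A', B, B', C, C'} t := by
  have hΓ := h.homogeneous
  have hirr := h.irreducible
  have hPP := hS hP
  obtain ⟨W, hWs, hWP, hWP', hconj⟩ := hPP.exists_form hJ hΓ
  have hW : IsPencilForm P W := h.isPencilForm hWs hWP (hWP' ▸ hPP.gradAt_ne_zero)
    (hconj _ _ (hS .baseA).conj) (hconj _ _ (hS .baseB).conj) (hconj _ _ (hS .baseC).conj)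
  have htP := hPP.polarLine_join hJ hΓ hW hWP' ht
  have hex : ∃ Q Q' S S' : ProjPoint, SchroeterPair A A' B B' C C' Q Q' ∧
      SchroeterPair A A' B B' C C' S S' ∧ FourDistinctLines P Q Q' S S' := by
    obtain ⟨X, X', hX, hd⟩ := h.exists_six_pairs hJ hS
    obtain ⟨i, j, hij⟩ := hPP.exists_fourDistinctLines hJ hΓ hirr hW hconj (fun i => hS (hX i)) hd
    exact ⟨_, _, _, _, hX i, hX j, hij⟩
  refine ⟨hex, ?_, ?_⟩
  · intro Q Q' S S' hQ hS' hfour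
    obtain ⟨hPQ, hPQ', hPS, hPS', hnd⟩ := hfour
    have eQ := hW.polarLine_join hPQ hPQ' (hconj _ _ (hS hQ).conj)
    have eS := hW.polarLine_join hPS hPS' (hconj _ _ (hS hS').conj)
    refine ⟨⟨polarLine P W, hW.isLineInvolution, eQ, eS⟩, ?_⟩
    rintro Λ ⟨hΛ, hΛQ, hΛS⟩
    rw [← htP]
    exact hΛ.eq_of_eq hW.isLineInvolution (onLine_join_left hPQ) (onLine_join_left hPS)
      (onLine_join_left hPP.ne) (by rwa [hΛQ, hΛS]) (eQ.trans hΛQ.symm) (eS.trans hΛS.symm)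
  · obtain ⟨Q, Q', S, S', hQ, hS', hfour⟩ := hex
    rw [← htP]
    exact hPP.rulerLine_tangent hJ hΓ hirr hW hconj (hS hQ) (hS hS') hfour hP.rulerPoint.1
      hP.rulerPoint.2 hQ.rulerPoint.1 hQ.rulerPoint.2 hS'.rulerPoint.1 hS'.rulerPoint.2

theorem corollary10
    (A A' B B' C C' D E F : ProjPoint)
    (hD : D = meet (join A B) (join A' B'))
    (hE : E = meet (join B C) (join B' C'))
    (hF : F = meet (join C A) (join C' A'))
    (hdistinct : [A, A', B, B', C, C', D, E, F].Nodup)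
    (hcollinear : NoFourCollinear {A, A', B, B', C, C'})
    (Γ : MvPolynomial (Fin 3) ℝ)
    (hcubic : Γ.IsHomogeneous 3) (hirred : Irreducible Γ)
    (hΓ : ∀ X ∈ [A, A', B, B', C, C', D, E, F], OnCurve Γ X)
    (P P' : ProjPoint) (hP : SchroeterPair A A' B B' C C' P P') :
    P ≠ P' ∧
    ∃ (t t' : ProjLine) (R : ProjPoint),
      IsTangentAt Γ P t ∧ IsTangentAt Γ P' t' ∧
      -- the tangent at `P` is obtained by a line involution
      (∃ Q Q' S S' : ProjPoint, SchroeterPair A A' B B' C C' Q Q' ∧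
        SchroeterPair A A' B B' C C' S S' ∧ FourDistinctLines P Q Q' S S') ∧
      (∀ Q Q' S S' : ProjPoint, SchroeterPair A A' B B' C C' Q Q' →
        SchroeterPair A A' B B' C C' S S' → FourDistinctLines P Q Q' S S' →
        (∃ Λ, IsLineInvolutionGivenBy P Q Q' S S' Λ) ∧
        ∀ Λ, IsLineInvolutionGivenBy P Q Q' S S' Λ → Λ (join P P') = t) ∧
      -- the tangents are constructible by ruler alone from the six given points
      RulerLine {A, A', B, B', C, C'} t ∧ RulerLine {A, A', B, B', C, C'} t' ∧
      -- the tangents meet in the point `P # P = P' # P'` of the cubic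
      t ≠ t' ∧ R = meet t t' ∧ OnCurve Γ R ∧ IsSharp Γ P P R ∧ IsSharp Γ P' P' R ∧
      RulerPoint {A, A', B, B', C, C'} R := by
  have h := IsSchroeterConfig.of_meet hD hE hF hdistinct hcubic hirred hΓ
  obtain ⟨N, hJ, hA, hB, hC⟩ := h.exists_isJacobian
  have hS : ∀ {P P'}, SchroeterPair A A' B B' C C' P P' → IsConjPair Γ N P P' :=
    fun hP => hP.isConjPair hJ hcubic hirred (h.isConjPair hA) (h.rotate.isConjPair hB)
      (h.rotate.rotate.isConjPair hC)
  have hPP := hS hP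
  have ht := hPP.isTangentAt hJ
  have ht' := (hPP.symm hJ).isTangentAt hJ
  obtain ⟨hex, hall, hr⟩ := h.tangent hJ hS hP ht
  obtain ⟨-, -, hr'⟩ := h.tangent hJ hS hP.symm ht'
  have hne := hPP.tangent_ne hJ hcubic hirred ht ht'
  have hR := meet_onLine_left hne
  have hR' := meet_onLine_right hne
  have hsharp := hPP.lineMeetsCubicIn hJ hcubic hirred ht ht' hR hR'
  have hsharp' := (hPP.symm hJ).lineMeetsCubicIn hJ hcubic hirred ht' ht hR' hR
  refine ⟨hPP.ne, _, _, _, ht, ht', hex, hall, hr, hr', hne, rfl, ?_, ⟨_, fun _ => ht, hsharp⟩,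
    ⟨_, fun _ => ht', hsharp'⟩, .meet hr hr' hne⟩
  -- The factorization of the cubic on the tangent contains `det(t, R, x)`, which vanishes at `x =
  -- R`.
  obtain ⟨-, -, hRt, c, -, hc⟩ := hsharp
  rw [OnCurve, hc _ (by rw [dotProduct_comm, ← onLine_iff]; exact hRt),
    det_eq_dotProduct_cross _ (Projectivization.rep (meet _ _)) _, cross_self]
  simp
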